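/- **Setting.** Let $p$ be a prime and let $G$ be the Vilenkin group: the group of all sequences $x=(x_k)_{k\in\mathbb Z}$, $x_k\in\mathbb Z/p\mathbb Z$, with $x_k=0$ for all sufficiently negative $k$, under coordinatewise addition modulo $p$. The subgroups $G_n=\{x: x_k=0 \text{ for all } k<n\}$, $n\in\mathbb Z$, form a base of neighbourhoods of zero. Let $X$ be the group of (continuous unitary) characters of $G$, $(\chi,x)$ the value of $\chi\in X$ at $x\in G$, and $G_n^\perp=\{\chi\in X:(\chi,x)=1 \text{ for all } x\in G_n\}$. Let $\mu$ and $\nu$ be the Haar measures on $G$ and $X$ with $\mu(G_0)=1$ and $\nu(G_0^\perp)=1$. The dilation $\mathcal A:G\to G$ is $(\mathcal A x)_k=x_{k+1}$, and $\chi\mathcal A^n\in X$ is defined by $(\chi\mathcal A^n,x)=(\chi,\mathcal A^n x)$ for $n\in\mathbb Z$; for $E\subset X$ put $E\mathcal A^n=\{\chi\mathcal A^n:\chi\in E\}$. Let $H_0=\{h\in G: h_k=0 \text{ for all } k\ge 0\}$, and fix characters $r_n\in G_{n+1}^\perp\setminus G_n^\perp$, $n\in\mathbb Z$. Write $\hat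 f(\chi)=\int_G f(x)\overline{(\chi,x)}\,d\mu(x)$. For integers $M,N\ge 0$ let $\mathfrak D_{G_M}(G_{-N})$ be the set of $f\in L_2(G)$ that vanish outside $G_{-N}$ and are constant on the cosets of $G_M$. For $\beta=(\beta_h)\in\ell^2(H_0)$, the mask of $\beta$ is $m(\chi)=\sum_{h\in H_0}\beta_h\overline{(\chi\mathcal A^{-1},h)}$, where the series converges in $L_2(G_k^\perp,\nu)$ for every $k\in\mathbb Z$. **Theorem 3.1.** Let $\varphi\in\mathfrak D_{G_M}(G_{-N})$ be a refinable function with a mask $m_0$, i.e. for some $\beta^{(0)}\in\ell^2(H_0)$ with mask $m_0$, $$\varphi(x)=p\sum_{h\in H_0}\beta^{(0)}_h\,\varphi(\mathcal A x-h).$$ Let $m_1,\dots,m_q$ be the masks of sequences $\beta^{(1)},\dots,\beta^{(q)}\in\ell^2(H_0)$, and put $\psi^{(j)}(x)=p\sum_{h\in H_0}\beta^{(j)}_h\,\varphi(\mathcal A x-h)$, $j=1,\dots,q$. Suppose that: 1) for every $j$, $\hat\varphi(\chi\mathcal A^{-1})\,m_j(\chi)=\mathbf 1_{E_j}(\chi)$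 for $\nu$-almost every $\chi\in X$, where $$E_j=G_{-s(j)}^\perp\, r_{-s(j)}^{\alpha^{(j)}_{-s(j)}}r_{-s(j)+1}^{\alpha^{(j)}_{-s(j)+1}}\cdots r_0^{\alpha^{(j)}_0}\cdots r_M^{\alpha^{(j)}_M}$$ for some integer $s(j)\ge 0$ and exponents $\alpha^{(j)}_k\in\{0,1,\dots,p-1\}$, and the sets $E_j\mathcal A^{t}$, $1\le j\le q$, $t\in\mathbb Z$, are pairwise disjoint (in particular, for $t=0$, the $E_j$ are pairwise disjoint); 2) there are integers $t(j)\ge 0$ such that $$\bigsqcup_{j=1}^{q}E_j\mathcal A^{t(j)}=G_{M+1}^\perp\setminus G_M^\perp .$$ Then $\psi^{(1)},\dots,\psi^{(q)}$ generate a tight (Parseval) wavelet frame of $L_2(G)$: each $\psi^{(j)}$ belongs to $L_2(G)$ and, with $\psi^{(j)}_{n,h}(x)=p^{n/2}\psi^{(j)}(\mathcal A^n x-h)$, $$\sum_{j=1}^{q}\ \sum_{n\in\mathbb Z}\ \sum_{h\in H_0}\bigl|\langle f,\psi^{(j)}_{n,h}\rangle\bigr|^2=\|f\|_{L_2(G)}^2\qquad\text{for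 all } f\in L_2(G).$$ -/

import Mathlib

open MeasureTheory Filter Topology
open scoped ENNReal ComplexConjugate

noncomputable section

/-- The sequences `x : ℤ → ZMod p` that vanish for all sufficiently negative indices, as a
subgroup (under coordinatewise addition modulo `p`) of all two-sided sequences. -/
def vilenkinSubgroup (p : ℕ) : AddSubgroup (ℤ → ZMod p) where
  carrier := {x | ∃ m : ℤ, ∀ k < m, x k = 0}
  zero_mem' := ⟨0, fun _ _ => rfl⟩
  add_mem' := by
    rintro x y ⟨m, hm⟩ ⟨n, hn⟩
    refine ⟨min m n, fun k hk => ?_⟩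
    simp [hm k (lt_of_lt_of_le hk (min_le_left _ _)), hn k (lt_of_lt_of_le hk (min_le_right _ _))]
  neg_mem' := by
    rintro x ⟨m, hm⟩
    exact ⟨m, fun k hk => by simp [hm k hk]⟩

/-- The Vilenkin group. It is a separate type, because its topology (below) is not the one induced
by the product topology. -/
def Vilenkin (p : ℕ) : Type := ↥(vilenkinSubgroup p)

namespace Vilenkin

instance (p : ℕ) : AddCommGroup (Vilenkin p) :=
  inferInstanceAs (AddCommGroup ↥(vilenkinSubgroup p))

/-- The `k`-th coordinate of `x`. -/
def coord {p : ℕ} (x : Vilenkin p) (k : ℤ) : ZMod p := x.1 k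

theorem coord_add {p : ℕ} (x y : Vilenkin p) (k : ℤ) :
    (x + y).coord k = x.coord k + y.coord k := rfl

theorem coord_zero {p : ℕ} (k : ℤ) : (0 : Vilenkin p).coord k = 0 := rfl

theorem coord_neg {p : ℕ} (x : Vilenkin p) (k : ℤ) : (-x).coord k = -x.coord k := rfl

theorem ext_coord {p : ℕ} {x y : Vilenkin p} (h : ∀ k, x.coord k = y.coord k) : x = y :=
  Subtype.ext (funext h)

/-- The subgroup `G_n` of all `x` whose coordinates with index `< n` vanish. -/
def subG (p : ℕ) (n : ℤ) : AddSubgroup (Vilenkin p) where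
  carrier := {x | ∀ k < n, x.coord k = 0}
  zero_mem' := fun _ _ => rfl
  add_mem' := by
    intro x y hx hy k hk
    rw [coord_add, hx k hk, hy k hk, add_zero]
  neg_mem' := by
    intro x hx k hk
    rw [coord_neg, hx k hk, neg_zero]

theorem mem_subG {p : ℕ} {n : ℤ} {x : Vilenkin p} :
    x ∈ subG p n ↔ ∀ k < n, x.coord k = 0 := Iff.rfl

/-- The subgroups `G_n`, `n ∈ ℤ`, are declared to be a basis of neighbourhoods of zero. -/
abbrev filterBasis (p : ℕ) : AddGroupFilterBasis (Vilenkin p) :=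
  addGroupFilterBasisOfComm {U | ∃ n : ℤ, U = (subG p n : Set (Vilenkin p))}
    ⟨_, 0, rfl⟩
    (by
      rintro _ _ ⟨m, rfl⟩ ⟨n, rfl⟩
      exact ⟨_, ⟨max m n, rfl⟩, fun x hx =>
        ⟨fun k hk => hx k (lt_of_lt_of_le hk (le_max_left _ _)),
          fun k hk => hx k (lt_of_lt_of_le hk (le_max_right _ _))⟩⟩)
    (by
      rintro _ ⟨n, rfl⟩
      exact (subG p n).zero_mem)
    (by
      rintro _ ⟨n, rfl⟩
      refine ⟨_, ⟨n, rfl⟩, ?_⟩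
      rintro _ ⟨x, hx, y, hy, rfl⟩
      exact (subG p n).add_mem hx hy)
    (by
      rintro _ ⟨n, rfl⟩
      exact ⟨_, ⟨n, rfl⟩, fun x hx => (subG p n).neg_mem hx⟩)

instance (p : ℕ) : TopologicalSpace (Vilenkin p) := (filterBasis p).topology

instance (p : ℕ) : IsTopologicalAddGroup (Vilenkin p) := (filterBasis p).isTopologicalAddGroup

instance (p : ℕ) : MeasurableSpace (Vilenkin p) := borel _

instance (p : ℕ) : BorelSpace (Vilenkin p) := ⟨rfl⟩

theorem subG_mem_nhds_zero (p : ℕ) (n : ℤ) : (subG p n : Set (Vilenkin p)) ∈ 𝓝 0 :=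
  (filterBasis p).mem_nhds_zero ⟨n, rfl⟩

theorem mem_nhds_zero_iff {p : ℕ} {U : Set (Vilenkin p)} :
    U ∈ 𝓝 0 ↔ ∃ n : ℤ, (subG p n : Set (Vilenkin p)) ⊆ U := by
  rw [(filterBasis p).nhds_zero_hasBasis.mem_iff]
  constructor
  · rintro ⟨_, ⟨n, rfl⟩, h⟩
    exact ⟨n, h⟩
  · rintro ⟨n, h⟩
    exact ⟨_, ⟨n, rfl⟩, h⟩

/-- The `n`-th power `𝒜ⁿ` (`n ∈ ℤ`) of the dilation operator `𝒜 : G → G`; the dilation itself,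
`𝒜 (∑ aₖ gₖ) = ∑ aₖ gₖ₋₁`, is the case `n = 1`, that is `(𝒜 x)ₖ = xₖ₊₁`. -/
def dil (p : ℕ) (n : ℤ) : Vilenkin p →+ Vilenkin p where
  toFun x := ⟨fun k => x.coord (k + n), by
    obtain ⟨m, hm⟩ := x.2
    exact ⟨m - n, fun k hk => hm (k + n) (by linarith)⟩⟩
  map_zero' := rfl
  map_add' _ _ := rfl

theorem coord_dil {p : ℕ} (n : ℤ) (x : Vilenkin p) (k : ℤ) :
    (dil p n x).coord k = x.coord (k + n) := rfl

theorem dil_zero {p : ℕ} (x : Vilenkin p) : dil p 0 x = x :=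
  ext_coord fun k => by rw [coord_dil, add_zero]

theorem dil_add {p : ℕ} (m n : ℤ) (x : Vilenkin p) : dil p (m + n) x = dil p m (dil p n x) :=
  ext_coord fun k => by rw [coord_dil, coord_dil, coord_dil, add_assoc]

theorem continuous_dil (p : ℕ) (n : ℤ) : Continuous (dil p n) := by
  refine continuous_of_continuousAt_zero (dil p n) ?_
  rw [ContinuousAt, map_zero]
  intro U hU
  obtain ⟨m, hm⟩ := mem_nhds_zero_iff.1 hU
  refine mem_map.2 (mem_nhds_zero_iff.2 ⟨m + n, fun x hx => hm fun k hk => ?_⟩)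
  rw [coord_dil]
  exact hx (k + n) (by linarith)

/-- The set `H₀` of all finite sums `a₋₁ g₋₁ + ⋯ + a₋ₛ g₋ₛ`: the elements of `G` all of whose
coordinates with index `≥ 0` vanish (only finitely many of the others are nonzero, since the
element belongs to `G`). -/
def H0 (p : ℕ) : Set (Vilenkin p) := {h | ∀ k : ℤ, 0 ≤ k → h.coord k = 0}

/-- The group `X` of (continuous, unitary) characters of the Vilenkin group, with its usual
topology. -/
abbrev Char (p : ℕ) : Type := PontryaginDual (Multiplicative (Vilenkin p))

instance (p : ℕ) : MeasurableSpace (Char p) := borel _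

instance (p : ℕ) : BorelSpace (Char p) := ⟨rfl⟩

/-- The value `(χ, x)` of the character `χ` at `x`. -/
def pair {p : ℕ} (χ : Char p) (x : Vilenkin p) : ℂ := (χ (Multiplicative.ofAdd x) : Circle)

/-- The annihilator `G_n^⊥`. -/
def annih (p : ℕ) (n : ℤ) : Subgroup (Char p) where
  carrier := {χ | ∀ x ∈ subG p n, pair χ x = 1}
  one_mem' := fun x _ => by simp [pair]
  mul_mem' := by
    intro χ η hχ hη x hx
    have h1 := hχ x hx
    have h2 := hη x hx
    change ((χ (Multiplicative.ofAdd x) * η (Multiplicative.ofAdd x) : Circle) : ℂ) = 1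
    rw [Circle.coe_mul]
    exact (congrArg₂ (· * ·) h1 h2).trans (one_mul 1)
  inv_mem' := by
    intro χ hχ x hx
    have h1 := hχ x hx
    change (((χ (Multiplicative.ofAdd x))⁻¹ : Circle) : ℂ) = 1
    rw [Circle.coe_inv]
    exact (congrArg (·⁻¹) h1).trans inv_one

/-- The character `χ𝒜ⁿ`, given by `(χ𝒜ⁿ, x) = (χ, 𝒜ⁿ x)`. -/
def dualDil (p : ℕ) (n : ℤ) : Char p → Char p :=
  PontryaginDual.map
    { toMonoidHom := AddMonoidHom.toMultiplicative (dil p n)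
      continuous_toFun := continuous_dil p n }

theorem pair_dualDil {p : ℕ} (n : ℤ) (χ : Char p) (x : Vilenkin p) :
    pair (dualDil p n χ) x = pair χ (dil p n x) := rfl

/-- The class `𝔇_{G_M}(G_{-N})`: the functions of `L₂(G)` that vanish outside `G_{-N}` and are
constant on the cosets of `G_M`. -/
def StepClass {p : ℕ} (μ : Measure (Vilenkin p)) (M N : ℕ) (f : Vilenkin p → ℂ) : Prop :=
  MemLp f 2 μ ∧ (∀ x, x ∉ subG p (-(N : ℤ)) → f x = 0) ∧
    ∀ x, ∀ y ∈ subG p (M : ℤ), f (x + y) = f x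

/-- The Fourier transform `f̂(χ) = ∫ f(x) conj (χ, x) dμ(x)` (used for integrable `f`). -/
def fourier {p : ℕ} (μ : Measure (Vilenkin p)) (f : Vilenkin p → ℂ) (χ : Char p) : ℂ :=
  ∫ x, f x * conj (pair χ x) ∂μ

/-- The function `x ↦ p ∑_{h ∈ H₀} β_h φ(𝒜x - h)`. If `φ` vanishes outside some `G_{-N}`, then for
each `x` only finitely many summands are nonzero. -/
def refine {p : ℕ} (φ : Vilenkin p → ℂ) (β : H0 p → ℂ) (x : Vilenkin p) : ℂ :=
  (p : ℂ) * ∑' h : H0 p, β h * φ (dil p 1 x - h)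

/-- `m` is the mask `m(χ) = ∑_{h ∈ H₀} β_h conj (χ𝒜⁻¹, h)` of a sequence `β ∈ ℓ²(H₀)`: the series
converges (unconditionally) to `m` in `L₂(G_k^⊥, ν)` for every `k`. In particular `m` is determined
up to `ν`-null sets. -/
def IsMask {p : ℕ} (ν : Measure (Char p)) (β : H0 p → ℂ) (m : Char p → ℂ) : Prop :=
  Memℓp β 2 ∧ AEStronglyMeasurable m ν ∧
    ∀ k : ℤ, Tendsto
      (fun F : Finset (H0 p) => eLpNorm
        (fun χ => m χ - ∑ h ∈ F, β h * conj (pair (dualDil p (-1) χ) h)) 2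
        (ν.restrict (annih p k : Set (Char p))))
      atTop (𝓝 0)

/-- `r` is a Rademacher system: `r_n ∈ G_{n+1}^⊥ \ G_n^⊥` for every `n`. -/
def IsRademacher {p : ℕ} (r : ℤ → Char p) : Prop :=
  ∀ n : ℤ, r n ∈ annih p (n + 1) ∧ r n ∉ annih p n

/-- The coset `G_{-s}^⊥ r_{-s}^{α_{-s}} r_{-s+1}^{α_{-s+1}} ⋯ r_0^{α_0} ⋯ r_M^{α_M}`. -/
def coset {p : ℕ} (r : ℤ → Char p) (M s : ℕ) (α : ℤ → Fin p) : Set (Char p) :=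
  {χ | ∃ ω ∈ annih p (-(s : ℤ)),
    χ = ω * ∏ k ∈ Finset.Icc (-(s : ℤ)) (M : ℤ), r k ^ (α k : ℕ)}

/-- The function `ψ_{n,h}(x) = p^{n/2} ψ(𝒜ⁿ x - h)`. -/
def atom {p : ℕ} (ψ : Vilenkin p → ℂ) (n : ℤ) (h : Vilenkin p) (x : Vilenkin p) : ℂ :=
  (((p : ℝ) ^ ((n : ℝ) / 2) : ℝ) : ℂ) * ψ (dil p n x - h)

/-- The functions `ψ j` generate a tight wavelet frame of `L₂(G)`: they belong to `L₂(G)`, and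
`∑_{j, n, h} |⟨f, ψ^{(j)}_{n,h}⟩|² = ‖f‖²` for all `f ∈ L₂(G)`. The system is indexed by `j`, `n` and
`h`, so that coinciding functions are counted as often as they occur. -/
def GeneratesTightFrame {p : ℕ} (μ : Measure (Vilenkin p)) {q : ℕ}
    (ψ : Fin q → Vilenkin p → ℂ) : Prop :=
  (∀ j, MemLp (ψ j) 2 μ) ∧
    ∀ f : Lp ℂ 2 μ,
      HasSum (fun i : Fin q × ℤ × H0 p =>
        ‖∫ x, f x * conj (atom (ψ i.1) i.2.1 i.2.2 x) ∂μ‖ ^ 2) (‖f‖ ^ 2)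

end Vilenkin

end

noncomputable section

namespace Vilenkin

variable {p : ℕ}

/-! ### Characters -/

/-! Condition 1 says that ψ^(j) has Fourier transform 1_{E_j}, where E_j is a coset ξ_j G_{-s(j)}^⊥.
Hence ψ^(j) is p^{-s(j)} ξ_j on G_{-s(j)} and 0 elsewhere; `refine_eq_indicator` proves this at
every point by integrating the mask series against a trigonometric polynomial.

Consequently ψ^(j)_{n,h} is a modulated indicator of a coset of G_{n-s(j)}, and its inner product
with f is, up to a constant, a Fourier coefficient of f on that coset. The squares, summed over h,
give the `energy` of f in E_j𝒜ⁿ (`tsum_enorm_integral_mul_conj_atom`). For f supported in some G_K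
this energy is the integral of |f̂|² over E_j𝒜ⁿ (`energy_eq_lintegral`).

By condition 2 the dilates of the E_j cover every shell G_{k+1}^⊥ \ G_k^⊥. Being disjoint, they tile
⋃ G_k^⊥ minus the null set ⋂ G_k^⊥ (`iUnion_dualDil_image`), so for a step function f the energies
add up to ‖f‖² by Plancherel. That case of Plancherel comes from the energy itself: its behaviour
under refinement (`energy_succ`) is the finite Parseval identity on ℤ/p, and at a fine level it is
visibly ‖f‖² (`energy_one_of_const`).

Step functions are dense (`topologicalClosure_stepSpan`), and Parseval's identity extends from a
dense subspace (`tsum_enorm_inner_sq_of_dense`). -/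

theorem pair_add (χ : Char p) (x y : Vilenkin p) : pair χ (x + y) = pair χ x * pair χ y := by
  unfold pair
  rw [ofAdd_add, map_mul, Circle.coe_mul]

theorem pair_zero (χ : Char p) : pair χ 0 = 1 := by
  unfold pair
  rw [ofAdd_zero, map_one, Circle.coe_one]

theorem pair_one (x : Vilenkin p) : pair (1 : Char p) x = 1 := by simp [pair]

theorem pair_mul (χ η : Char p) (x : Vilenkin p) : pair (χ * η) x = pair χ x * pair η x :=
  Circle.coe_mul _ _

theorem pair_neg (χ : Char p) (x : Vilenkin p) : pair χ (-x) = conj (pair χ x) := by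
  unfold pair
  rw [ofAdd_neg, map_inv, Circle.coe_inv_eq_conj]

theorem pair_sub (χ : Char p) (x y : Vilenkin p) :
    pair χ (x - y) = pair χ x * conj (pair χ y) := by
  rw [sub_eq_add_neg, pair_add, pair_neg]

theorem pair_nsmul (χ : Char p) (n : ℕ) (x : Vilenkin p) : pair χ (n • x) = pair χ x ^ n := by
  induction n with
  | zero => rw [zero_smul, pair_zero, pow_zero]
  | succ n ih => rw [succ_nsmul, pair_add, ih, pow_succ]

theorem pair_pow (χ : Char p) (n : ℕ) (x : Vilenkin p) : pair (χ ^ n) x = pair χ x ^ n := by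
  induction n with
  | zero => rw [pow_zero, pair_one, pow_zero]
  | succ n ih => rw [pow_succ, pair_mul, ih, pow_succ]

@[simp]
theorem norm_pair (χ : Char p) (x : Vilenkin p) : ‖pair χ x‖ = 1 := Circle.norm_coe _

@[simp]
theorem enorm_pair (χ : Char p) (x : Vilenkin p) : ‖pair χ x‖ₑ = 1 := by
  rw [← ofReal_norm, norm_pair, ENNReal.ofReal_one]

theorem continuous_pair (χ : Char p) : Continuous (pair χ) :=
  continuous_subtype_val.comp ((map_continuous χ).comp continuous_ofAdd)

theorem continuous_pair_left (x : Vilenkin p) : Continuous fun χ : Char p => pair χ x :=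
  continuous_subtype_val.comp
    (continuous_eval_const (F := ContinuousMonoidHom (Multiplicative (Vilenkin p)) Circle)
      (Multiplicative.ofAdd x))

theorem char_ext {χ η : Char p} (h : ∀ x, pair χ x = pair η x) : χ = η :=
  PontryaginDual.ext fun a => Circle.coe_injective (h a.toAdd)

theorem dualDil_mul (n : ℤ) (χ η : Char p) :
    dualDil p n (χ * η) = dualDil p n χ * dualDil p n η :=
  char_ext fun x => by simp only [pair_mul, pair_dualDil]

theorem dualDil_add (m n : ℤ) (χ : Char p) :
    dualDil p (m + n) χ = dualDil p m (dualDil p n χ) :=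
  char_ext fun x => by simp only [pair_dualDil, add_comm m n, dil_add]

theorem dualDil_zero (χ : Char p) : dualDil p 0 χ = χ :=
  char_ext fun x => by simp only [pair_dualDil, dil_zero]

theorem continuous_dualDil (n : ℤ) : Continuous (dualDil p n) :=
  (PontryaginDual.map _).continuous_toFun

/-! ### The subgroups `G_n`, their annihilators and cosets -/

theorem subG_anti {m n : ℤ} (h : m ≤ n) : subG p n ≤ subG p m :=
  fun _ hx k hk => hx k (hk.trans_le h)

theorem annih_mono {m n : ℤ} (h : m ≤ n) : annih p m ≤ annih p n :=
  fun _ hχ x hx => hχ x (subG_anti h hx)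

theorem mem_annih {n : ℤ} {χ : Char p} : χ ∈ annih p n ↔ ∀ x ∈ subG p n, pair χ x = 1 := Iff.rfl

theorem dil_mem_subG {n k : ℤ} {x : Vilenkin p} : dil p n x ∈ subG p k ↔ x ∈ subG p (k + n) := by
  constructor
  · intro h i hi
    have := h (i - n) (by linarith)
    rwa [coord_dil, sub_add_cancel] at this
  · intro h i hi
    exact h (i + n) (by linarith)

theorem dil_dil_neg (n : ℤ) (x : Vilenkin p) : dil p n (dil p (-n) x) = x := by
  rw [← dil_add, add_neg_cancel, dil_zero]

theorem dil_neg_dil (n : ℤ) (x : Vilenkin p) : dil p (-n) (dil p n x) = x := by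
  rw [← dil_add, neg_add_cancel, dil_zero]

theorem dualDil_mem_annih {n k : ℤ} {χ : Char p} :
    dualDil p n χ ∈ annih p k ↔ χ ∈ annih p (k - n) := by
  constructor
  · intro h x hx
    have := h (dil p (-n) x) (dil_mem_subG.2 (by simpa [sub_eq_add_neg] using hx))
    rwa [pair_dualDil, dil_dil_neg] at this
  · intro h x hx
    rw [pair_dualDil]
    exact h _ (dil_mem_subG.2 (by simpa using hx))

theorem isOpen_subG (n : ℤ) : IsOpen (subG p n : Set (Vilenkin p)) :=
  AddSubgroup.isOpen_of_mem_nhds _ (subG_mem_nhds_zero p n)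

theorem isClosed_annih (n : ℤ) : IsClosed (annih p n : Set (Char p)) := by
  have : (annih p n : Set (Char p)) = ⋂ x ∈ subG p n, {χ | pair χ x = 1} := by
    ext χ
    simp [mem_annih]
  rw [this]
  exact isClosed_biInter fun x _ => isClosed_eq (continuous_pair_left x) continuous_const

/-- The coset `a + G_n`. -/
def ball (n : ℤ) (a : Vilenkin p) : Set (Vilenkin p) := {x | x - a ∈ subG p n}

/-- The coset `ξ G_n^⊥`. -/
def dualBall (n : ℤ) (ξ : Char p) : Set (Char p) := {χ | ξ⁻¹ * χ ∈ annih p n}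

theorem mem_ball {n : ℤ} {a x : Vilenkin p} : x ∈ ball n a ↔ x - a ∈ subG p n := Iff.rfl

theorem mem_dualBall {n : ℤ} {ξ χ : Char p} : χ ∈ dualBall n ξ ↔ ξ⁻¹ * χ ∈ annih p n := Iff.rfl

theorem isOpen_ball (n : ℤ) (a : Vilenkin p) : IsOpen (ball n a) :=
  (isOpen_subG n).preimage (continuous_id.sub continuous_const)

theorem measurableSet_ball (n : ℤ) (a : Vilenkin p) : MeasurableSet (ball n a) :=
  (isOpen_ball n a).measurableSet

theorem measurableSet_annih (n : ℤ) : MeasurableSet (annih p n : Set (Char p)) :=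
  (isClosed_annih n).measurableSet

theorem measurableSet_dualBall (n : ℤ) (ξ : Char p) : MeasurableSet (dualBall n ξ) :=
  ((isClosed_annih n).preimage (continuous_const.mul continuous_id)).measurableSet

theorem ball_zero (n : ℤ) : ball n 0 = (subG p n : Set (Vilenkin p)) := by
  ext x
  simp [mem_ball]

theorem dualBall_one (n : ℤ) : dualBall n 1 = (annih p n : Set (Char p)) := by
  ext x
  simp [mem_dualBall]

theorem ball_eq_of_mem {n : ℤ} {a b : Vilenkin p} (h : b ∈ ball n a) : ball n b = ball n a := by
  ext x
  rw [mem_ball, mem_ball, ← sub_add_sub_cancel x b a]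
  exact (AddSubgroup.add_mem_cancel_right _ h).symm

theorem ball_subset {m n : ℤ} (h : m ≤ n) (a : Vilenkin p) : ball n a ⊆ ball m a :=
  fun _ hx => subG_anti h hx

theorem dualDil_image_dualBall (n k : ℤ) (ξ : Char p) :
    dualDil p n '' dualBall k ξ = dualBall (k + n) (dualDil p n ξ) := by
  have key : ∀ m k : ℤ, ∀ ξ χ : Char p, χ ∈ dualBall k ξ →
      dualDil p m χ ∈ dualBall (k + m) (dualDil p m ξ) := by
    intro m k ξ χ h
    have h2 : dualDil p m (ξ⁻¹ * χ) ∈ annih p (k + m) := dualDil_mem_annih.2 (by rwa [add_sub_cancel_right])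
    have h3 : (dualDil p m ξ)⁻¹ * dualDil p m χ = dualDil p m (ξ⁻¹ * χ) := by
      rw [inv_mul_eq_iff_eq_mul, ← dualDil_mul, mul_inv_cancel_left]
    rw [mem_dualBall, h3]
    exact h2
  ext χ
  constructor
  · rintro ⟨χ, h, rfl⟩
    exact key n k ξ χ h
  · intro h
    refine ⟨dualDil p (-n) χ, ?_, ?_⟩
    · have := key (-n) _ _ _ h
      rwa [← dualDil_add, neg_add_cancel, dualDil_zero, add_neg_cancel_right] at this
    · rw [← dualDil_add, add_neg_cancel, dualDil_zero]

/-! ### Digits -/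

/-- The element of `G` whose only nonzero coordinate is a `1` at `k`. -/
def gen (p : ℕ) (k : ℤ) : Vilenkin p :=
  ⟨Pi.single k 1, k, fun i hi => by simp [hi.ne]⟩

theorem coord_gen (k i : ℤ) : (gen p k).coord i = if i = k then 1 else 0 :=
  Pi.single_apply k 1 i

theorem coord_nsmul (n : ℕ) (x : Vilenkin p) (k : ℤ) : (n • x).coord k = n * x.coord k := by
  induction n with
  | zero => simp [coord_zero]
  | succ n ih => rw [succ_nsmul, coord_add, ih]; push_cast; ring

theorem coord_sub (x y : Vilenkin p) (k : ℤ) : (x - y).coord k = x.coord k - y.coord k := by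
  rw [sub_eq_add_neg, coord_add, coord_neg, sub_eq_add_neg]

theorem coord_nsmul_gen (n : ℕ) (k i : ℤ) :
    (n • gen p k).coord i = if i = k then (n : ZMod p) else 0 := by
  rw [coord_nsmul, coord_gen]
  split_ifs <;> simp

theorem gen_mem_subG (k : ℤ) : gen p k ∈ subG p k := fun i hi => by simp [coord_gen, hi.ne]

theorem mem_subG_succ {k : ℤ} {x : Vilenkin p} :
    x ∈ subG p (k + 1) ↔ x ∈ subG p k ∧ x.coord k = 0 := by
  constructor
  · intro h
    exact ⟨subG_anti (by linarith) h, h k (by linarith)⟩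
  · rintro ⟨h, h0⟩ i hi
    rcases (Int.lt_add_one_iff.1 hi).lt_or_eq with h1 | rfl
    · exact h i h1
    · exact h0

theorem sub_nsmul_gen_mem_subG_succ {k : ℤ} {x : Vilenkin p} (hx : x ∈ subG p k) (n : ℕ) :
    x - n • gen p k ∈ subG p (k + 1) ↔ x.coord k = n := by
  rw [mem_subG_succ, coord_sub, coord_nsmul_gen, if_pos rfl, sub_eq_zero]
  exact and_iff_right (sub_mem hx (nsmul_mem (gen_mem_subG k) n))

theorem nsmul_eq_zero (x : Vilenkin p) : p • x = 0 :=
  ext_coord fun k => by rw [coord_nsmul, CharP.cast_eq_zero, zero_mul, coord_zero]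

theorem natCast_fin_injective [NeZero p] {c d : Fin p} (h : ((c : ℕ) : ZMod p) = (d : ℕ)) :
    c = d := by
  have := (ZMod.natCast_eq_natCast_iff' _ _ _).1 h
  rw [Nat.mod_eq_of_lt c.2, Nat.mod_eq_of_lt d.2] at this
  exact Fin.ext this

theorem exists_natCast_fin [NeZero p] (z : ZMod p) : ∃ c : Fin p, ((c : ℕ) : ZMod p) = z :=
  ⟨⟨z.val, ZMod.val_lt z⟩, ZMod.natCast_zmod_val z⟩

theorem ball_eq_iUnion [NeZero p] (k : ℤ) (a : Vilenkin p) :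
    ball k a = ⋃ c : Fin p, ball (k + 1) (a + (c : ℕ) • gen p k) := by
  ext x
  simp only [Set.mem_iUnion, mem_ball, ← sub_sub]
  constructor
  · intro h
    obtain ⟨c, hc⟩ := exists_natCast_fin ((x - a).coord k)
    exact ⟨c, (sub_nsmul_gen_mem_subG_succ h _).2 hc.symm⟩
  · rintro ⟨c, hc⟩
    have := add_mem (mem_subG_succ.1 hc).1 (nsmul_mem (gen_mem_subG k) (c : ℕ))
    rwa [sub_add_cancel] at this

theorem pairwise_disjoint_ball [NeZero p] (k : ℤ) (a : Vilenkin p) :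
    Pairwise (Function.onFun Disjoint
      fun c : Fin p => ball (k + 1) (a + (c : ℕ) • gen p k)) := by
  intro c d hcd
  refine Set.disjoint_left.2 fun x hc hd => hcd (natCast_fin_injective ?_)
  have hx : x - a ∈ subG p k := by
    have : x ∈ ball k a := by
      rw [ball_eq_iUnion]
      exact Set.mem_iUnion.2 ⟨c, hc⟩
    exact this
  rw [mem_ball, ← sub_sub, sub_nsmul_gen_mem_subG_succ hx] at hc hd
  rw [← hc, ← hd]

/-! ### The lattices of points with finitely many digits -/

/-- The points of `G` whose coordinates with index `≥ n` vanish. -/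
def lattice (p : ℕ) (n : ℤ) : Set (Vilenkin p) := {h | ∀ k : ℤ, n ≤ k → h.coord k = 0}

theorem lattice_inter_subG_finite [NeZero p] (n m : ℤ) :
    (lattice p n ∩ subG p m : Set (Vilenkin p)).Finite := by
  -- Only the digits with index in [m, n) are free, and each takes finitely many values.
  have hinj : Set.InjOn (fun (x : Vilenkin p) (k : Set.Ico m n) => x.coord k)
      (lattice p n ∩ subG p m) := by
    rintro x ⟨hx, hx'⟩ y ⟨hy, hy'⟩ hxy
    refine ext_coord fun k => ?_
    rcases lt_or_ge k m with h1 | h1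
    · rw [hx' k h1, hy' k h1]
    rcases lt_or_ge k n with h2 | h2
    · exact congrFun hxy ⟨k, h1, h2⟩
    · rw [hx k h2, hy k h2]
  exact Set.Finite.of_finite_image (Set.toFinite _) hinj

instance [NeZero p] (n : ℤ) : Countable (lattice p n) := by
  have : lattice p n = ⋃ m : ℤ, (lattice p n ∩ subG p m : Set (Vilenkin p)) := by
    ext x
    simp only [Set.mem_iUnion, Set.mem_inter_iff, exists_and_left]
    obtain ⟨m, hm⟩ := x.2
    exact ⟨fun h => ⟨h, m, hm⟩, fun h => h.1⟩
  rw [this]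
  exact (Set.countable_iUnion fun m => (lattice_inter_subG_finite n m).countable).to_subtype

/-- Every point is congruent modulo `G_n` to its truncation. -/
def trunc (n : ℤ) (x : Vilenkin p) : Vilenkin p :=
  ⟨fun k => if k < n then x.coord k else 0, by
    obtain ⟨m, hm⟩ := x.2
    exact ⟨m, fun k hk => ite_eq_right_iff.2 fun _ => hm k hk⟩⟩

theorem coord_trunc (n : ℤ) (x : Vilenkin p) (k : ℤ) :
    (trunc n x).coord k = if k < n then x.coord k else 0 := rfl

theorem trunc_mem_lattice (n : ℤ) (x : Vilenkin p) : trunc n x ∈ lattice p n :=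
  fun k hk => by rw [coord_trunc, if_neg hk.not_gt]

theorem sub_mem_subG_iff {n : ℤ} {x y : Vilenkin p} :
    x - y ∈ subG p n ↔ ∀ k < n, x.coord k = y.coord k := by
  simp only [mem_subG, coord_sub, sub_eq_zero]

theorem mem_ball_trunc (n : ℤ) (x : Vilenkin p) : x ∈ ball n (trunc n x) :=
  sub_mem_subG_iff.2 fun k hk => by rw [coord_trunc, if_pos hk]

theorem eq_trunc_of_mem_ball {n : ℤ} {a x : Vilenkin p} (ha : a ∈ lattice p n)
    (h : x ∈ ball n a) : a = trunc n x := by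
  refine ext_coord fun k => ?_
  rw [coord_trunc]
  split_ifs with hk
  · exact (sub_mem_subG_iff.1 h k hk).symm
  · exact ha k (not_lt.1 hk)

theorem pairwise_disjoint_ball_lattice (n : ℤ) :
    Pairwise (Function.onFun Disjoint fun a : lattice p n => ball n (a : Vilenkin p)) := by
  intro a b hab
  refine Set.disjoint_left.2 fun x ha hb => hab (Subtype.ext ?_)
  rw [eq_trunc_of_mem_ball a.2 ha, eq_trunc_of_mem_ball b.2 hb]

theorem iUnion_ball_lattice (n : ℤ) :
    ⋃ a : lattice p n, ball n (a : Vilenkin p) = Set.univ :=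
  Set.eq_univ_of_forall fun x =>
    Set.mem_iUnion.2 ⟨⟨trunc n x, trunc_mem_lattice n x⟩, mem_ball_trunc n x⟩

/-- A point with digits below `n + 1` splits into one with digits below `n` and its last digit. -/
def latticeSuccEquiv [NeZero p] (n : ℤ) : lattice p n × Fin p ≃ lattice p (n + 1) :=
  Equiv.ofBijective
    (fun q => ⟨q.1 + (q.2 : ℕ) • gen p n, fun k hk => by
      rw [coord_add, coord_nsmul_gen, if_neg (by linarith), q.1.2 k (by linarith), add_zero]⟩) <| by
    constructor
    · rintro ⟨a, c⟩ ⟨b, d⟩ h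
      have hk : ∀ k, a.1.coord k + ((c : ℕ) • gen p n).coord k =
          b.1.coord k + ((d : ℕ) • gen p n).coord k := fun k =>
        congrArg (fun y => coord y k) (Subtype.ext_iff.1 h)
      simp only [coord_nsmul_gen] at hk
      have hcd : c = d := natCast_fin_injective (by simpa [a.2 n le_rfl, b.2 n le_rfl] using hk n)
      subst hcd
      have hab : a = b := Subtype.ext (ext_coord fun k => by simpa using hk k)
      rw [hab]
    · rintro ⟨x, hx⟩
      obtain ⟨c, hc⟩ := exists_natCast_fin (x.coord n)
      refine ⟨(⟨x - (c : ℕ) • gen p n, fun k hk => ?_⟩, c), Subtype.ext (sub_add_cancel _ _)⟩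
      rw [coord_sub, coord_nsmul_gen]
      split_ifs with h
      · rw [h, hc, sub_self]
      · rw [hx k (by omega), sub_zero]

theorem coe_latticeSuccEquiv [NeZero p] (n : ℤ) (q : lattice p n × Fin p) :
    (latticeSuccEquiv n q : Vilenkin p) = q.1 + (q.2 : ℕ) • gen p n := rfl

theorem tsum_lattice_succ [NeZero p] (n : ℤ) (F : Vilenkin p → ℝ≥0∞) :
    ∑' a : lattice p (n + 1), F a =
      ∑' a : lattice p n, ∑ c : Fin p, F (a + (c : ℕ) • gen p n) := by
  rw [← (latticeSuccEquiv n).tsum_eq, ENNReal.tsum_prod']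
  simp only [coe_latticeSuccEquiv, tsum_fintype]

/-- `F` does not see the digits with index ≥ n, so each of the s additional digits merely repeats
every term p times. -/
theorem tsum_lattice_add [NeZero p] (n : ℤ) (s : ℕ) (F : Vilenkin p → ℝ≥0∞)
    (hF : ∀ x, ∀ y ∈ subG p n, F (x + y) = F x) :
    ∑' a : lattice p (n + s), F a = (p : ℝ≥0∞) ^ s * ∑' a : lattice p n, F a := by
  induction s with
  | zero =>
    rw [pow_zero, one_mul, Nat.cast_zero, add_zero]
  | succ s ih =>
    have h1 : (n + (s + 1 : ℕ) : ℤ) = n + s + 1 := by push_cast; ring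
    rw [h1, tsum_lattice_succ]
    have h2 : ∀ (a : Vilenkin p) (c : Fin p), F (a + (c : ℕ) • gen p (n + s)) = F a :=
      fun a c => hF _ _ (nsmul_mem (subG_anti (by linarith [Int.natCast_nonneg s]) (gen_mem_subG _)) _)
    simp only [h2, Finset.sum_const, Finset.card_univ, Fintype.card_fin, nsmul_eq_mul]
    rw [ENNReal.tsum_mul_left, ih, pow_succ']
    ring

/-! ### Roots of unity -/

/-- This is a geometric sum with ratio ζ = ω^(d-c). Since ζ^p = 1, the sum times ζ - 1 vanishes, and
ζ ≠ 1 unless c = d. -/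
theorem sum_conj_rootOfUnity_mul {ω : ℂ} (hω : IsPrimitiveRoot ω p) (h1 : ‖ω‖ = 1) (c d : Fin p) :
    ∑ i : Fin p, conj (ω ^ ((i : ℕ) * c)) * ω ^ ((i : ℕ) * d) = if c = d then (p : ℂ) else 0 := by
  have h0 : ω ≠ 0 := fun h => by simp [h] at h1
  have hc : conj ω = ω⁻¹ := (Complex.inv_eq_conj h1).symm
  set ζ : ℂ := (ω ^ (c : ℕ))⁻¹ * ω ^ (d : ℕ) with hζ
  have hterm : ∀ i : Fin p, conj (ω ^ ((i : ℕ) * c)) * ω ^ ((i : ℕ) * d) = ζ ^ (i : ℕ) := by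
    intro i
    rw [map_pow, hc, hζ, mul_pow, inv_pow, inv_pow, ← pow_mul, ← pow_mul, mul_comm (c : ℕ),
      mul_comm (d : ℕ)]
  simp only [hterm]
  rw [Fin.sum_univ_eq_sum_range (fun i => ζ ^ i) p]
  split_ifs with h
  · have : ζ = 1 := by rw [hζ, h, inv_mul_cancel₀ (pow_ne_zero _ h0)]
    simp [this]
  · have hne : ζ ≠ 1 := fun h' => by
      rw [hζ, inv_mul_eq_one₀ (pow_ne_zero _ h0)] at h'
      exact h (Fin.ext (hω.pow_inj c.2 d.2 h'))
    have hp : ζ ^ p = 1 := by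
      rw [hζ, mul_pow, inv_pow, ← pow_mul, ← pow_mul, mul_comm (c : ℕ), mul_comm (d : ℕ), pow_mul,
        pow_mul, hω.pow_eq_one, one_pow, one_pow, inv_one, one_mul]
    have := geom_sum_mul ζ p
    rw [hp, sub_self] at this
    exact (mul_eq_zero.1 this).resolve_right (sub_ne_zero.2 hne)

/-- The finite Parseval identity on `ℤ/p`. -/
theorem sum_norm_sq_rootOfUnity {ω : ℂ} (hω : IsPrimitiveRoot ω p) (h1 : ‖ω‖ = 1) (u : Fin p → ℂ) :
    ∑ i : Fin p, ‖∑ c : Fin p, conj (ω ^ ((i : ℕ) * c)) * u c‖ ^ 2 = p * ∑ c, ‖u c‖ ^ 2 := by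
  apply Complex.ofReal_injective
  push_cast
  simp only [← Complex.mul_conj']
  calc ∑ i : Fin p, (∑ c : Fin p, conj (ω ^ ((i : ℕ) * c)) * u c) *
        conj (∑ c : Fin p, conj (ω ^ ((i : ℕ) * c)) * u c)
      = ∑ i : Fin p, ∑ c : Fin p, ∑ d : Fin p,
          u c * conj (u d) * (conj (ω ^ ((i : ℕ) * c)) * ω ^ ((i : ℕ) * d)) := by
        refine Finset.sum_congr rfl fun i _ => ?_
        rw [map_sum, Finset.sum_mul_sum]
        refine Finset.sum_congr rfl fun c _ => Finset.sum_congr rfl fun d _ => ?_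
        rw [map_mul, Complex.conj_conj]
        ring
    _ = ∑ c : Fin p, ∑ d : Fin p, u c * conj (u d) * (if c = d then (p : ℂ) else 0) := by
        rw [Finset.sum_comm]
        refine Finset.sum_congr rfl fun c _ => ?_
        rw [Finset.sum_comm]
        refine Finset.sum_congr rfl fun d _ => ?_
        rw [← Finset.mul_sum, sum_conj_rootOfUnity_mul hω h1]
    _ = p * ∑ c, u c * conj (u c) := by
        simp only [mul_ite, mul_zero, Finset.sum_ite_eq, Finset.mem_univ, if_true]
        rw [← Finset.sum_mul, mul_comm]

theorem sum_enorm_sq_rootOfUnity {ω : ℂ} (hω : IsPrimitiveRoot ω p) (h1 : ‖ω‖ = 1)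
    (u : Fin p → ℂ) :
    ∑ i : Fin p, ‖∑ c : Fin p, conj (ω ^ ((i : ℕ) * c)) * u c‖ₑ ^ 2 = p * ∑ c, ‖u c‖ₑ ^ 2 := by
  have h : ∀ z : ℂ, ‖z‖ₑ ^ 2 = ENNReal.ofReal (‖z‖ ^ 2) := fun z => by
    rw [ENNReal.ofReal_pow (norm_nonneg _), ofReal_norm]
  simp only [h]
  rw [← ENNReal.ofReal_sum_of_nonneg fun _ _ => by positivity,
    ← ENNReal.ofReal_sum_of_nonneg fun _ _ => by positivity, sum_norm_sq_rootOfUnity hω h1,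
    ENNReal.ofReal_mul (Nat.cast_nonneg _), ENNReal.ofReal_natCast]

/-! ### Rademacher characters -/

section Rademacher

/-- Modulo G_{k+1}, where χ is trivial, x equals n times `gen p k`. A character in G_{k+1}^⊥ is thus
determined on G_k by its value at `gen p k`. -/
theorem pair_eq_pow {k : ℤ} {χ : Char p} (hχ : χ ∈ annih p (k + 1)) {x : Vilenkin p}
    (hx : x ∈ subG p k) {n : ℕ} (hn : x.coord k = n) : pair χ x = pair χ (gen p k) ^ n := by
  have h := hχ _ ((sub_nsmul_gen_mem_subG_succ hx n).2 hn)
  rw [← sub_add_cancel x (n • gen p k), pair_add, h, one_mul, pair_nsmul]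

theorem pair_gen_pow (χ : Char p) (k : ℤ) : pair χ (gen p k) ^ p = 1 := by
  rw [← pair_nsmul, nsmul_eq_zero, pair_zero]

theorem mem_annih_of_pair_gen [NeZero p] {k : ℤ} {χ : Char p} (hχ : χ ∈ annih p (k + 1))
    (h : pair χ (gen p k) = 1) : χ ∈ annih p k := fun x hx => by
  rw [pair_eq_pow hχ hx (ZMod.natCast_zmod_val (x.coord k)).symm, h, one_pow]

theorem measure_dualBall_eq (ν : Measure (Char p)) [ν.IsHaarMeasure] (k : ℤ) (ξ : Char p) :
    ν (dualBall k ξ) = ν (annih p k : Set (Char p)) :=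
  measure_preimage_mul ν ξ⁻¹ (annih p k : Set (Char p))

theorem measure_ball_eq (μ : Measure (Vilenkin p)) [μ.IsAddHaarMeasure] (k : ℤ)
    (a : Vilenkin p) : μ (ball k a) = μ (subG p k : Set (Vilenkin p)) := by
  have : ball k a = (fun x => -a + x) ⁻¹' (subG p k : Set (Vilenkin p)) := by
    ext x
    rw [mem_ball, sub_eq_neg_add]
    rfl
  rw [this, measure_preimage_add]

theorem toReal_natCast_zpow (k : ℤ) : ((p : ℝ≥0∞) ^ k).toReal = (p : ℝ) ^ k := by
  cases k <;> simp [zpow_negSucc]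

variable [hp : Fact p.Prime] {r : ℤ → Char p}

theorem isPrimitiveRoot_pair_gen (hr : IsRademacher r) (k : ℤ) :
    IsPrimitiveRoot (pair (r k) (gen p k)) p := by
  have hne : pair (r k) (gen p k) ≠ 1 := fun h => (hr k).2 (mem_annih_of_pair_gen (hr k).1 h)
  have := IsPrimitiveRoot.orderOf (pair (r k) (gen p k))
  rwa [orderOf_eq_prime (pair_gen_pow _ _) hne] at this

/-- The value of ξ⁻¹χ at `gen p k` is a p-th root of unity, hence a power of the primitive root
(r_k, `gen p k`). Dividing by that power of r_k leaves a character trivial on G_k. -/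
theorem dualBall_succ_eq_iUnion (hr : IsRademacher r) (k : ℤ) (ξ : Char p) :
    dualBall (k + 1) ξ = ⋃ i : Fin p, dualBall k (ξ * r k ^ (i : ℕ)) := by
  ext χ
  simp only [Set.mem_iUnion, mem_dualBall, mul_inv_rev, mul_assoc]
  constructor
  · intro h
    obtain ⟨i, hi, h'⟩ := (isPrimitiveRoot_pair_gen hr k).eq_pow_of_pow_eq_one
      (pair_gen_pow (ξ⁻¹ * χ) k)
    refine ⟨⟨i, hi⟩, mem_annih_of_pair_gen (mul_mem (inv_mem (pow_mem (hr k).1 _)) h) ?_⟩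
    rw [pair_mul, ← h', ← pair_pow, ← pair_mul, inv_mul_cancel, pair_one]
  · rintro ⟨i, hi⟩
    have := mul_mem (pow_mem (hr k).1 (i : ℕ)) (annih_mono (by linarith : k ≤ k + 1) hi)
    rwa [mul_inv_cancel_left] at this

theorem pairwise_disjoint_dualBall (hr : IsRademacher r) (k : ℤ) (ξ : Char p) :
    Pairwise (Function.onFun Disjoint fun i : Fin p => dualBall k (ξ * r k ^ (i : ℕ))) := by
  intro i j hij
  have key : ∀ i : Fin p, ∀ χ ∈ dualBall k (ξ * r k ^ (i : ℕ)),
      pair (ξ⁻¹ * χ) (gen p k) = pair (r k) (gen p k) ^ (i : ℕ) := by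
    intro i χ h
    have h1 := h _ (gen_mem_subG k)
    rw [← mul_inv_cancel_left (ξ * r k ^ (i : ℕ)) χ, mul_assoc, inv_mul_cancel_left, pair_mul,
      h1, mul_one, pair_pow]
  refine Set.disjoint_left.2 fun χ hi hj => hij (Fin.ext ?_)
  exact (isPrimitiveRoot_pair_gen hr k).pow_inj i.2 j.2 ((key i χ hi).symm.trans (key j χ hj))

/-- Characters in `G_n^⊥` separate the points outside `G_n` from zero. -/
theorem exists_mem_annih_pair_ne_one (hr : IsRademacher r) {n : ℤ} {x : Vilenkin p}
    (hx : x ∉ subG p n) : ∃ η ∈ annih p n, pair η x ≠ 1 := by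
  obtain ⟨m, hm⟩ := x.2
  have hne : ∃ k, x.coord k ≠ 0 := by
    by_contra! h
    exact hx fun k _ => h k
  -- The witness is r_k for the first nonzero digit k of x: there r_k takes a nontrivial power of a
  -- primitive p-th root of unity.
  obtain ⟨k, hk, hmin⟩ := Int.exists_least_of_bdd
    (P := fun k => x.coord k ≠ 0) ⟨m, fun z hz => not_lt.1 fun h => hz (hm z h)⟩ hne
  have hkx : x ∈ subG p k := fun i hi => not_not.1 fun h => (hmin i h).not_gt hi
  have hkn : k < n := not_le.1 fun h => hx (subG_anti h hkx)
  refine ⟨r k, annih_mono (by omega) (hr k).1, ?_⟩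
  rw [pair_eq_pow (hr k).1 hkx (ZMod.natCast_zmod_val (x.coord k)).symm]
  exact (isPrimitiveRoot_pair_gen hr k).pow_ne_one_of_pos_of_lt
    (fun h => hk ((ZMod.val_eq_zero _).1 h)) (ZMod.val_lt _)

/-! ### Haar measures of cosets -/

theorem zpow_of_succ {F : ℤ → ℝ≥0∞} {a : ℝ≥0∞} (ha : a ≠ 0) (ha' : a ≠ ⊤) (h0 : F 0 = 1)
    (h : ∀ k, F (k + 1) = a * F k) (k : ℤ) : F k = a ^ k := by
  induction k using Int.induction_on with
  | zero => rw [h0, zpow_zero]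
  | succ n ih => rw [h, ih, ENNReal.zpow_add ha ha', zpow_one, mul_comm]
  | pred n ih =>
    have h1 := h (-n - 1)
    rw [sub_add_cancel, ih] at h1
    have h2 : a ^ (-(n : ℤ)) = a * a ^ (-(n : ℤ) - 1) := by
      nth_rw 2 [← zpow_one a]
      rw [← ENNReal.zpow_add ha ha', add_sub_cancel]
    exact ((ENNReal.mul_right_inj ha ha').1 (h2.symm.trans h1)).symm

theorem prime_cast_ne_zero : (p : ℝ≥0∞) ≠ 0 := Nat.cast_ne_zero.2 hp.out.ne_zero

theorem prime_zpow_ne_top (k : ℤ) : (p : ℝ≥0∞) ^ k ≠ ⊤ :=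
  ENNReal.zpow_ne_top prime_cast_ne_zero (ENNReal.natCast_ne_top p) k

theorem prime_zpow_add (m n : ℤ) : (p : ℝ≥0∞) ^ (m + n) = p ^ m * p ^ n :=
  ENNReal.zpow_add prime_cast_ne_zero (ENNReal.natCast_ne_top p) m n

theorem measure_dualBall (hr : IsRademacher r) (ν : Measure (Char p)) [ν.IsHaarMeasure]
    (hν : ν (annih p 0 : Set (Char p)) = 1) (k : ℤ) (ξ : Char p) :
    ν (dualBall k ξ) = (p : ℝ≥0∞) ^ k := by
  rw [measure_dualBall_eq]
  refine zpow_of_succ (F := fun k => ν (annih p k : Set (Char p)))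
    prime_cast_ne_zero (ENNReal.natCast_ne_top p) hν (fun k => ?_) k
  rw [← dualBall_one, dualBall_succ_eq_iUnion hr,
    measure_iUnion (pairwise_disjoint_dualBall hr k 1) fun _ => measurableSet_dualBall _ _]
  simp only [measure_dualBall_eq, tsum_fintype, Finset.sum_const, Finset.card_univ,
    Fintype.card_fin, nsmul_eq_mul]

theorem measure_ball (μ : Measure (Vilenkin p)) [μ.IsAddHaarMeasure]
    (hμ : μ (subG p 0 : Set (Vilenkin p)) = 1) (k : ℤ) (a : Vilenkin p) :
    μ (ball k a) = (p : ℝ≥0∞) ^ (-k) := by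
  have h := zpow_of_succ (F := fun k => μ (subG p (-k) : Set (Vilenkin p)))
    prime_cast_ne_zero (ENNReal.natCast_ne_top p) (by simpa using hμ) (fun k => ?_) (-k)
  · rw [measure_ball_eq, ← h, neg_neg]
  · have hk : -k = -(k + 1) + 1 := by ring
    rw [← ball_zero, ball_eq_iUnion,
      measure_iUnion (pairwise_disjoint_ball _ 0) fun _ => measurableSet_ball _ _]
    simp only [measure_ball_eq, ← hk, tsum_fintype, Finset.sum_const, Finset.card_univ,
      Fintype.card_fin, nsmul_eq_mul]

theorem measure_ball_ne_top (μ : Measure (Vilenkin p)) [μ.IsAddHaarMeasure]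
    (hμ : μ (subG p 0 : Set (Vilenkin p)) = 1) (k : ℤ) (a : Vilenkin p) : μ (ball k a) ≠ ⊤ := by
  rw [measure_ball μ hμ]
  exact prime_zpow_ne_top _

theorem measureReal_ball (μ : Measure (Vilenkin p)) [μ.IsAddHaarMeasure]
    (hμ : μ (subG p 0 : Set (Vilenkin p)) = 1) (k : ℤ) (a : Vilenkin p) :
    μ.real (ball k a) = (p : ℝ) ^ (-k) := by
  rw [measureReal_def, measure_ball μ hμ, toReal_natCast_zpow]

/-! ### Integrals of characters -/

open Classical in
theorem setIntegral_dualBall_pair (hr : IsRademacher r) (ν : Measure (Char p)) [ν.IsHaarMeasure]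
    (hν : ν (annih p 0 : Set (Char p)) = 1) (k : ℤ) (ξ : Char p) (x : Vilenkin p) :
    ∫ χ in dualBall k ξ, pair χ x ∂ν = if x ∈ subG p k then (p : ℂ) ^ k * pair ξ x else 0 := by
  split_ifs with hx
  · have h : Set.EqOn (fun χ => pair χ x) (fun _ => pair ξ x) (dualBall k ξ) := fun χ hχ => by
      have := hχ x hx
      dsimp only
      rw [← mul_inv_cancel_left ξ χ, pair_mul, this, mul_one]
    rw [setIntegral_congr_fun (measurableSet_dualBall k ξ) h, setIntegral_const, measureReal_def,
      measure_dualBall hr ν hν, toReal_natCast_zpow, Complex.real_smul]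
    push_cast
    rfl
  -- Translation by η preserves the coset and the measure but multiplies the integrand by (η, x) ≠
  -- 1, so the integral vanishes.
  · obtain ⟨η, hη, hne⟩ := exists_mem_annih_pair_ne_one hr hx
    have h := integral_mul_left_eq_self (μ := ν) ((dualBall k ξ).indicator fun χ => pair χ x) η
    have h2 : ∀ χ, (dualBall k ξ).indicator (fun χ => pair χ x) (η * χ) =
        pair η x * (dualBall k ξ).indicator (fun χ => pair χ x) χ := by
      intro χ
      have hmem : η * χ ∈ dualBall k ξ ↔ χ ∈ dualBall k ξ := by
        rw [mem_dualBall, mem_dualBall, mul_left_comm]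
        exact Subgroup.mul_mem_cancel_left _ hη
      by_cases hχ : χ ∈ dualBall k ξ
      · rw [Set.indicator_of_mem (hmem.2 hχ), Set.indicator_of_mem hχ, pair_mul]
      · rw [Set.indicator_of_notMem (mt hmem.1 hχ), Set.indicator_of_notMem hχ, mul_zero]
    simp only [h2] at h
    rw [integral_const_mul, integral_indicator (measurableSet_dualBall k ξ)] at h
    have h3 : (pair η x - 1) * ∫ χ in dualBall k ξ, pair χ x ∂ν = 0 := by
      rw [sub_mul, h, one_mul, sub_self]
    exact (mul_eq_zero.1 h3).resolve_left (sub_ne_zero.2 hne)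

end Rademacher

/-! ### Local Fourier coefficients -/

/-- The Fourier coefficient of `f` on the coset `a + G_k` at the character `ξ`. -/
def coeff (μ : Measure (Vilenkin p)) (f : Vilenkin p → ℂ) (k : ℤ) (ξ : Char p)
    (a : Vilenkin p) : ℂ :=
  ∫ x in ball k a, f x * conj (pair ξ x) ∂μ

/-- The energy of `f` in the frequency coset `ξ G_k^⊥`. -/
def energy (μ : Measure (Vilenkin p)) (f : Vilenkin p → ℂ) (k : ℤ) (ξ : Char p) : ℝ≥0∞ :=
  (p : ℝ≥0∞) ^ k * ∑' a : lattice p k, ‖coeff μ f k ξ a‖ₑ ^ 2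

/-- A character in G_k^⊥ is constant on a + G_k. Hence |`coeff`| at level k depends only on the
frequency coset ξ G_k^⊥. -/
theorem coeff_mul (μ : Measure (Vilenkin p)) (f : Vilenkin p → ℂ) {k : ℤ} {η : Char p}
    (hη : η ∈ annih p k) (ξ : Char p) (a : Vilenkin p) :
    coeff μ f k (ξ * η) a = conj (pair η a) * coeff μ f k ξ a := by
  unfold coeff
  rw [← integral_const_mul]
  refine setIntegral_congr_fun (measurableSet_ball k a) fun x hx => ?_
  have h : pair η x = pair η a := by
    rw [← sub_add_cancel x a, pair_add, hη _ hx, one_mul]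
  simp only [pair_mul, h, map_mul]
  ring

theorem coeff_congr_ball (μ : Measure (Vilenkin p)) (f : Vilenkin p → ℂ) {k : ℤ} (ξ : Char p)
    {a b : Vilenkin p} (h : b ∈ ball k a) : coeff μ f k ξ b = coeff μ f k ξ a := by
  unfold coeff
  rw [ball_eq_of_mem h]

theorem integrableOn_mul_conj_pair {μ : Measure (Vilenkin p)} {f : Vilenkin p → ℂ}
    {s : Set (Vilenkin p)} (hf : IntegrableOn f s μ) (ξ : Char p) :
    IntegrableOn (fun x => f x * conj (pair ξ x)) s μ :=
  Integrable.mul_bdd (c := 1) hf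
    (Complex.continuous_conj.comp (continuous_pair ξ)).aestronglyMeasurable
    (ae_of_all _ fun x => by rw [RCLike.norm_conj, norm_pair])

theorem coeff_eq_sum [NeZero p] {μ : Measure (Vilenkin p)} {f : Vilenkin p → ℂ}
    (hf : ∀ k a, IntegrableOn f (ball k a) μ) (k : ℤ) (ξ : Char p) (a : Vilenkin p) :
    coeff μ f k ξ a = ∑ c : Fin p,
      ∫ x in ball (k + 1) (a + (c : ℕ) • gen p k), f x * conj (pair ξ x) ∂μ := by
  unfold coeff
  rw [ball_eq_iUnion, integral_iUnion_fintype (fun _ => measurableSet_ball _ _)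
    (pairwise_disjoint_ball k a) fun c => integrableOn_mul_conj_pair (hf _ _) ξ]

theorem fourier_eq_coeff {μ : Measure (Vilenkin p)} {f : Vilenkin p → ℂ} {k : ℤ}
    (hf : ∀ x, x ∉ subG p k → f x = 0) (ξ : Char p) : fourier μ f ξ = coeff μ f k ξ 0 := by
  unfold fourier coeff
  rw [ball_zero, setIntegral_eq_integral_of_forall_compl_eq_zero]
  intro x hx
  rw [hf x hx, zero_mul]

theorem coeff_eq_zero {μ : Measure (Vilenkin p)} {f : Vilenkin p → ℂ} {k : ℤ}
    (hf : ∀ x, x ∉ subG p k → f x = 0) (ξ : Char p) {a : Vilenkin p} (ha : a ∉ subG p k) :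
    coeff μ f k ξ a = 0 := by
  refine setIntegral_eq_zero_of_forall_eq_zero fun x hx => ?_
  rw [hf x, zero_mul]
  intro h
  refine ha ?_
  have := sub_mem h hx
  rwa [sub_sub_cancel] at this

theorem energy_of_support {μ : Measure (Vilenkin p)} {f : Vilenkin p → ℂ} {k : ℤ}
    (hf : ∀ x, x ∉ subG p k → f x = 0) (ξ : Char p) :
    energy μ f k ξ = (p : ℝ≥0∞) ^ k * ‖fourier μ f ξ‖ₑ ^ 2 := by
  unfold energy
  rw [tsum_eq_single (⟨0, fun _ _ => coord_zero _⟩ : lattice p k), fourier_eq_coeff hf]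
  intro a ha
  rw [coeff_eq_zero hf, enorm_zero, zero_pow two_ne_zero]
  intro h
  refine ha (Subtype.ext (ext_coord fun i => ?_))
  rcases lt_or_ge i k with hi | hi
  · rw [h i hi, coord_zero]
  · rw [a.2 i hi, coord_zero]

section Prime

variable [hp : Fact p.Prime] {r : ℤ → Char p}

/-- Passing from level k + 1 to k merges p cosets in G and splits the frequency coset into p. Up to
unimodular factors, the p new coefficients are the discrete Fourier transform of the p old ones. The
factor p in the finite Parseval identity is the ratio of the weights p^{k+1} and p^k. -/
theorem energy_succ (hr : IsRademacher r) {μ : Measure (Vilenkin p)} {f : Vilenkin p → ℂ}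
    (hf : ∀ k a, IntegrableOn f (ball k a) μ) (k : ℤ) (ξ : Char p) :
    energy μ f (k + 1) ξ = ∑ i : Fin p, energy μ f k (ξ * r k ^ (i : ℕ)) := by
  have hω := isPrimitiveRoot_pair_gen hr k
  have key : ∀ (i : Fin p) (a : Vilenkin p), ‖coeff μ f k (ξ * r k ^ (i : ℕ)) a‖ₑ =
      ‖∑ c : Fin p, conj (pair (r k) (gen p k) ^ ((i : ℕ) * c)) *
        coeff μ f (k + 1) ξ (a + (c : ℕ) • gen p k)‖ₑ := by
    intro i a
    have h : coeff μ f k (ξ * r k ^ (i : ℕ)) a = conj (pair (r k ^ (i : ℕ)) a) *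
        ∑ c : Fin p, conj (pair (r k) (gen p k) ^ ((i : ℕ) * c)) *
          coeff μ f (k + 1) ξ (a + (c : ℕ) • gen p k) := by
      rw [coeff_eq_sum hf, Finset.mul_sum]
      refine Finset.sum_congr rfl fun c _ => ?_
      change coeff μ f (k + 1) _ _ = _
      rw [coeff_mul μ f (pow_mem (hr k).1 _), pair_add, pair_nsmul, pair_pow (r k) _ (gen p k),
        ← pow_mul, map_mul, mul_assoc]
    rw [h, enorm_mul, ← pair_neg, enorm_pair, one_mul]
  unfold energy
  rw [← Finset.mul_sum, prime_zpow_add, zpow_one, mul_assoc]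
  congr 1
  rw [← Summable.tsum_finsetSum fun _ _ => ENNReal.summable,
    tsum_lattice_succ k fun a => ‖coeff μ f (k + 1) ξ a‖ₑ ^ 2, ← ENNReal.tsum_mul_left]
  refine tsum_congr fun a => ?_
  simp only [key]
  rw [sum_enorm_sq_rootOfUnity hω (norm_pair _ _)]

/-- For k ≤ K a single coset carries f, and |f̂| is constant on ξ G_k^⊥, so both sides equal p^k
|f̂(ξ)|². For k > K both sides obey the same splitting rule, and induction on k - K applies. -/
theorem energy_eq_lintegral (hr : IsRademacher r) (ν : Measure (Char p)) [ν.IsHaarMeasure]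
    (hν : ν (annih p 0 : Set (Char p)) = 1) {μ : Measure (Vilenkin p)} {f : Vilenkin p → ℂ}
    (hf : ∀ k a, IntegrableOn f (ball k a) μ) {K : ℤ} (hK : ∀ x, x ∉ subG p K → f x = 0)
    (k : ℤ) (ξ : Char p) :
    energy μ f k ξ = ∫⁻ χ in dualBall k ξ, ‖fourier μ f χ‖ₑ ^ 2 ∂ν := by
  have base : ∀ k ≤ K, ∀ ξ,
      energy μ f k ξ = ∫⁻ χ in dualBall k ξ, ‖fourier μ f χ‖ₑ ^ 2 ∂ν := by
    intro k hk ξ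
    have hk' : ∀ x, x ∉ subG p k → f x = 0 := fun x hx => hK x fun h => hx (subG_anti hk h)
    have h : Set.EqOn (fun χ => ‖fourier μ f χ‖ₑ ^ 2) (fun _ => ‖fourier μ f ξ‖ₑ ^ 2)
        (dualBall k ξ) := fun χ hχ => by
      dsimp only
      rw [fourier_eq_coeff hk', fourier_eq_coeff hk', ← mul_inv_cancel_left ξ χ, coeff_mul μ f hχ,
        enorm_mul, ← pair_neg, enorm_pair, one_mul]
    rw [setLIntegral_congr_fun (measurableSet_dualBall k ξ) h, setLIntegral_const,
      measure_dualBall hr ν hν, energy_of_support hk', mul_comm]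
  have step : ∀ (n : ℕ) (ξ : Char p), energy μ f (K + n) ξ =
      ∫⁻ χ in dualBall (K + n) ξ, ‖fourier μ f χ‖ₑ ^ 2 ∂ν := by
    intro n
    induction n with
    | zero => exact base _ (by simp)
    | succ n ih =>
      intro ξ
      rw [Nat.cast_succ, ← add_assoc, energy_succ hr hf, dualBall_succ_eq_iUnion hr,
        lintegral_iUnion (fun _ => measurableSet_dualBall _ _) (pairwise_disjoint_dualBall hr _ ξ),
        tsum_fintype]
      simp only [ih]
  rcases le_total k K with h | h
  · exact base k h ξ
  · obtain ⟨n, rfl⟩ := Int.le.dest h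
    exact step n ξ

/-- On a + G_m the coefficient at the trivial character is p^{-m} f(a). Its square times the weight
p^m is p^{-m} |f(a)|², the integral of |f|² over that coset. -/
theorem energy_one_of_const {μ : Measure (Vilenkin p)} [μ.IsAddHaarMeasure]
    (hμ : μ (subG p 0 : Set (Vilenkin p)) = 1) {f : Vilenkin p → ℂ} {m : ℤ}
    (hm : ∀ x, ∀ y ∈ subG p m, f (x + y) = f x) :
    energy μ f m 1 = ∫⁻ x, ‖f x‖ₑ ^ 2 ∂μ := by
  have hconst : ∀ a x, x ∈ ball m a → f x = f a := fun a x hx => by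
    rw [← add_sub_cancel a x]
    exact hm a _ hx
  rw [← setLIntegral_univ (fun x => ‖f x‖ₑ ^ 2), ← iUnion_ball_lattice m,
    lintegral_iUnion (fun _ => measurableSet_ball _ _) (pairwise_disjoint_ball_lattice m)]
  unfold energy
  rw [← ENNReal.tsum_mul_left]
  refine tsum_congr fun a => ?_
  have h1 : coeff μ f m 1 a = (μ.real (ball m (a : Vilenkin p)) : ℂ) * f a := by
    unfold coeff
    rw [setIntegral_congr_fun (g := fun _ => f a) (measurableSet_ball m a.1), setIntegral_const,
      Complex.real_smul]
    intro x hx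
    simp only [pair_one, map_one, mul_one, hconst _ x hx]
  have h2 : ‖(μ.real (ball m (a : Vilenkin p)) : ℂ)‖ₑ = (p : ℝ≥0∞) ^ (-m) := by
    rw [← ofReal_norm, Complex.norm_real, Real.norm_of_nonneg measureReal_nonneg,
      ofReal_measureReal (measure_ball_ne_top μ hμ _ _), measure_ball μ hμ]
  rw [setLIntegral_congr_fun (g := fun _ => ‖f a‖ₑ ^ 2) (measurableSet_ball m a.1)
    (fun x hx => by simp only [hconst _ x hx]), setLIntegral_const, measure_ball μ hμ, h1,
    enorm_mul, h2, mul_pow, sq ((p : ℝ≥0∞) ^ (-m)), mul_assoc, ← mul_assoc, ← prime_zpow_add,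
    add_neg_cancel, zpow_zero, one_mul, mul_comm]

theorem measure_iInter_annih (hr : IsRademacher r) (ν : Measure (Char p)) [ν.IsHaarMeasure]
    (hν : ν (annih p 0 : Set (Char p)) = 1) : ν (⋂ k, (annih p k : Set (Char p))) = 0 := by
  have h : ∀ n : ℕ, ν (⋂ k, (annih p k : Set (Char p))) ≤ ((p : ℝ≥0∞)⁻¹) ^ n := fun n => by
    refine (measure_mono (Set.iInter_subset _ (-(n : ℤ)))).trans_eq ?_
    rw [← dualBall_one, measure_dualBall hr ν hν, ENNReal.zpow_neg, zpow_natCast, ENNReal.inv_pow]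
  refine le_antisymm (ge_of_tendsto' (ENNReal.tendsto_pow_atTop_nhds_zero_of_lt_one ?_) h) zero_le
  rw [ENNReal.inv_lt_one]
  exact_mod_cast hp.out.one_lt

/-- Plancherel's identity for step functions. -/
theorem lintegral_iUnion_annih_fourier (hr : IsRademacher r) (ν : Measure (Char p))
    [ν.IsHaarMeasure] (hν : ν (annih p 0 : Set (Char p)) = 1)
    {μ : Measure (Vilenkin p)} [μ.IsAddHaarMeasure]
    (hμ : μ (subG p 0 : Set (Vilenkin p)) = 1) {f : Vilenkin p → ℂ}
    (hf : ∀ k a, IntegrableOn f (ball k a) μ) {K m : ℤ} (hK : ∀ x, x ∉ subG p K → f x = 0)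
    (hm : ∀ x, ∀ y ∈ subG p m, f (x + y) = f x) :
    ∫⁻ χ in ⋃ k, (annih p k : Set (Char p)), ‖fourier μ f χ‖ₑ ^ 2 ∂ν = ∫⁻ x, ‖f x‖ₑ ^ 2 ∂μ := by
  have hmono : Monotone fun k : ℤ => (annih p k : Set (Char p)) := fun a b h => annih_mono h
  -- f is also constant on the cosets of the smaller G_k, so the integral over G_k^⊥ already has the
  -- full value once k ≥ m.
  have hk : ∀ k, m ≤ k → ∫⁻ χ in (annih p k : Set (Char p)), ‖fourier μ f χ‖ₑ ^ 2 ∂ν =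
      ∫⁻ x, ‖f x‖ₑ ^ 2 ∂μ := fun k hk => by
    rw [← dualBall_one, ← energy_eq_lintegral hr ν hν hf hK,
      energy_one_of_const hμ fun x y hy => hm x y (subG_anti hk hy)]
  -- As a measure with density, the integral over an increasing union is a supremum, with no need
  -- for measurability of the transform.
  rw [← withDensity_apply _ (MeasurableSet.iUnion measurableSet_annih), hmono.directed_le.measure_iUnion]
  simp only [withDensity_apply _ (measurableSet_annih _)]
  refine le_antisymm (iSup_le fun k => ?_) ((hk m le_rfl).symm.le.trans (le_iSup_of_le m le_rfl))
  exact (lintegral_mono_set (hmono (le_max_left k m))).trans_eq (hk _ (le_max_right k m))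

/-- If frequency cosets tile the nontrivial characters, the energies of a step function in them add
up to its total energy. -/
theorem tsum_energy_of_tiling (hr : IsRademacher r) (ν : Measure (Char p))
    [ν.IsHaarMeasure] (hν : ν (annih p 0 : Set (Char p)) = 1)
    {μ : Measure (Vilenkin p)} [μ.IsAddHaarMeasure]
    (hμ : μ (subG p 0 : Set (Vilenkin p)) = 1) {f : Vilenkin p → ℂ}
    (hf : ∀ k a, IntegrableOn f (ball k a) μ) {K m : ℤ} (hK : ∀ x, x ∉ subG p K → f x = 0)
    (hm : ∀ x, ∀ y ∈ subG p m, f (x + y) = f x)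
    {ι : Type*} [Countable ι] (k : ι → ℤ) (ξ : ι → Char p)
    (hdisj : Pairwise (Function.onFun Disjoint fun i => dualBall (k i) (ξ i)))
    (hunion : ⋃ i, dualBall (k i) (ξ i) =
      (⋃ k, (annih p k : Set (Char p))) \ ⋂ k, (annih p k : Set (Char p))) :
    ∑' i, energy μ f (k i) (ξ i) = ∫⁻ x, ‖f x‖ₑ ^ 2 ∂μ := by
  simp only [energy_eq_lintegral hr ν hν hf hK]
  rw [← lintegral_iUnion (fun _ => measurableSet_dualBall _ _) hdisj, hunion,
    setLIntegral_congr (sdiff_null_ae_eq_self (measure_iInter_annih hr ν hν)),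
    lintegral_iUnion_annih_fourier hr ν hν hμ hf hK hm]

end Prime

/-! ### Step functions and the generators -/

/-- A step function is the sum of its values on finitely many cosets. -/
theorem eq_sum_indicator_ball [NeZero p] {g : Vilenkin p → ℂ} {K m : ℤ} (hKm : K ≤ m)
    (hK : ∀ x, x ∉ subG p K → g x = 0) (hm : ∀ x, ∀ y ∈ subG p m, g (x + y) = g x)
    (x : Vilenkin p) :
    g x = ∑ a ∈ (lattice_inter_subG_finite m K).toFinset, (ball m a).indicator (fun _ => g a) x := by
  have hx : trunc m x ∈ subG p K ↔ x ∈ subG p K := by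
    have h1 : x - trunc m x ∈ subG p K := subG_anti hKm (mem_ball_trunc m x)
    constructor
    · intro h
      have := add_mem h1 h
      rwa [sub_add_cancel] at this
    · intro h
      have := sub_mem h h1
      rwa [sub_sub_cancel] at this
  have hg : g x = g (trunc m x) := by
    have := hm (trunc m x) _ (mem_ball_trunc m x)
    rwa [add_sub_cancel] at this
  rw [Finset.sum_eq_single (trunc m x)]
  · rw [Set.indicator_of_mem (mem_ball_trunc m x), hg]
  · intro b hb hne
    have hb' := (Set.Finite.mem_toFinset _).1 hb
    exact Set.indicator_of_notMem (fun h => hne (eq_trunc_of_mem_ball hb'.1 h)) _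
  · intro h
    rw [Set.indicator_of_mem (mem_ball_trunc m x)]
    refine hK _ fun h' => h ((Set.Finite.mem_toFinset _).2 ⟨trunc_mem_lattice m x, h'⟩)

section Prime

variable [hp : Fact p.Prime] {r : ℤ → Char p}

theorem fourier_stepFunction {μ : Measure (Vilenkin p)} [μ.IsAddHaarMeasure]
    (hμ : μ (subG p 0 : Set (Vilenkin p)) = 1) {g : Vilenkin p → ℂ} {K m : ℤ} (hKm : K ≤ m)
    (hK : ∀ x, x ∉ subG p K → g x = 0) (hm : ∀ x, ∀ y ∈ subG p m, g (x + y) = g x)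
    {η : Char p} (hη : η ∈ annih p m) :
    fourier μ g η = (p : ℂ) ^ (-m) *
      ∑ a ∈ (lattice_inter_subG_finite m K).toFinset, g a * conj (pair η a) := by
  -- For η in G_m^⊥ the product of g with the conjugate of η is again constant on the cosets of G_m.
  have h : ∀ x, g x * conj (pair η x) = ∑ a ∈ (lattice_inter_subG_finite m K).toFinset,
      (ball m a).indicator (fun _ => g a * conj (pair η a)) x := by
    refine eq_sum_indicator_ball (g := fun x => g x * conj (pair η x)) hKm
      (fun x hx => ?_) fun x y hy => ?_
    · rw [hK x hx, zero_mul]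
    · rw [hm x y hy, pair_add, hη y hy, mul_one]
  unfold fourier
  rw [integral_congr_ae (ae_of_all _ h), integral_finsetSum, Finset.mul_sum]
  · refine Finset.sum_congr rfl fun a _ => ?_
    rw [integral_indicator_const _ (measurableSet_ball m a), measureReal_ball μ hμ,
      Complex.real_smul]
    push_cast
    rfl
  · intro a _
    exact (integrable_indicator_iff (measurableSet_ball m a)).2
      (integrableOn_const (measure_ball_ne_top μ hμ m a))

/-- A generator whose Fourier transform is the indicator of a coset is a modulated indicator. -/
theorem refine_eq_indicator (hr : IsRademacher r) {μ : Measure (Vilenkin p)} [μ.IsAddHaarMeasure]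
    (hμ : μ (subG p 0 : Set (Vilenkin p)) = 1) {ν : Measure (Char p)} [ν.IsHaarMeasure]
    (hν : ν (annih p 0 : Set (Char p)) = 1) {φ : Vilenkin p → ℂ} {K m : ℤ} (hKm : K ≤ m)
    (hK : ∀ x, x ∉ subG p K → φ x = 0) (hm : ∀ x, ∀ y ∈ subG p m, φ (x + y) = φ x)
    {β : H0 p → ℂ} {w : Char p → ℂ} (hw : IsMask ν β w) {k : ℤ} {ξ : Char p}
    (hsub : dualBall k ξ ⊆ (annih p (m + 1) : Set (Char p)))
    (hE : ∀ᵐ χ ∂ν, fourier μ φ (dualDil p (-1) χ) * w χ =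
      (dualBall k ξ).indicator (fun _ => (1 : ℂ)) χ) (x : Vilenkin p) :
    refine φ β x = (subG p k : Set (Vilenkin p)).indicator (fun y => (p : ℂ) ^ k * pair ξ y) x := by
  classical
  have hp0 : (p : ℂ) ≠ 0 := Nat.cast_ne_zero.2 hp.out.ne_zero
  -- S contains the coset, and χ ∈ S means χ𝒜⁻¹ ∈ G_m^⊥, where the transform of φ is an explicit
  -- finite sum.
  set S : Set (Char p) := (annih p (m + 1) : Set (Char p)) with hS
  have hSm : MeasurableSet S := measurableSet_annih _
  set R := (lattice_inter_subG_finite (p := p) m K).toFinset with hR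
  have hνS : ν S ≠ ⊤ := by
    rw [hS, ← dualBall_one, measure_dualBall hr ν hν]
    exact prime_zpow_ne_top _
  have : IsFiniteMeasure (ν.restrict S) := ⟨by rwa [Measure.restrict_apply_univ, lt_top_iff_ne_top]⟩
  -- On S this is φ̂(χ𝒜⁻¹)(χ, x). As a trigonometric polynomial it is continuous and bounded on all
  -- of X.
  set B : Char p → ℂ := fun χ => ((p : ℂ) ^ (-m) *
    ∑ a ∈ R, φ a * conj (pair (dualDil p (-1) χ) a)) * pair χ x with hB
  have hcont : ∀ y, Continuous fun χ : Char p => conj (pair (dualDil p (-1) χ) y) := fun y =>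
    Complex.continuous_conj.comp ((continuous_pair_left y).comp (continuous_dualDil _))
  have hBcont : Continuous B := (continuous_const.mul
    (continuous_finsetSum _ fun a _ => continuous_const.mul (hcont a))).mul (continuous_pair_left x)
  set C : ℝ := ‖(p : ℂ) ^ (-m)‖ * ∑ a ∈ R, ‖φ a‖ with hC
  have hBC : ∀ χ, ‖B χ‖ ≤ C := fun χ => by
    rw [hB, hC]
    dsimp only
    rw [norm_mul, norm_pair, mul_one, norm_mul]
    gcongr
    refine (norm_sum_le _ _).trans (Finset.sum_le_sum fun a _ => ?_)
    rw [norm_mul, RCLike.norm_conj, norm_pair, mul_one]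
  set P : Finset (H0 p) → Char p → ℂ := fun F χ =>
    ∑ h ∈ F, β h * conj (pair (dualDil p (-1) χ) h) with hP
  have hPcont : ∀ F, Continuous (P F) := fun F =>
    continuous_finsetSum _ fun h _ => continuous_const.mul (hcont h)
  have hPC : ∀ F χ, ‖P F χ‖ ≤ ∑ h ∈ F, ‖β h‖ := fun F χ => by
    refine (norm_sum_le _ _).trans (Finset.sum_le_sum fun a _ => ?_)
    rw [norm_mul, RCLike.norm_conj, norm_pair, mul_one]
  have hBi : Integrable B (ν.restrict S) :=
    Integrable.of_bound hBcont.aestronglyMeasurable C (ae_of_all _ hBC)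
  have hPi : ∀ F, Integrable (P F) (ν.restrict S) := fun F =>
    Integrable.of_bound (hPcont F).aestronglyMeasurable _ (ae_of_all _ (hPC F))
  have hlim := hw.2.2 (m + 1)
  have hws : ∀ F, AEStronglyMeasurable (fun χ => w χ - P F χ) (ν.restrict S) := fun F =>
    hw.2.1.restrict.sub (hPcont F).aestronglyMeasurable
  -- Some partial sum is at finite L₂ distance from w, and S has finite measure.
  have hwi : Integrable w (ν.restrict S) := by
    obtain ⟨F, hF⟩ := (hlim.eventually_lt_const ENNReal.zero_lt_top).exists
    have h1 : MemLp (fun χ => w χ - P F χ) 2 (ν.restrict S) := ⟨hws F, hF⟩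
    have h2 := (h1.integrable one_le_two).add (hPi F)
    refine h2.congr (ae_of_all _ fun χ => ?_)
    simp
  have hBw : Integrable (fun χ => B χ * w χ) (ν.restrict S) :=
    hwi.bdd_mul hBcont.aestronglyMeasurable (ae_of_all _ hBC)
  have hBP : ∀ F, Integrable (fun χ => B χ * P F χ) (ν.restrict S) := fun F =>
    (hPi F).bdd_mul hBcont.aestronglyMeasurable (ae_of_all _ hBC)
  -- the integral against the mask
  have hI : ∫ χ in S, B χ * w χ ∂ν =
      (subG p k : Set (Vilenkin p)).indicator (fun y => (p : ℂ) ^ k * pair ξ y) x := by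
    have h1 : ∀ᵐ χ ∂ν, χ ∈ S →
        B χ * w χ = (dualBall k ξ).indicator (fun χ => pair χ x) χ := by
      filter_upwards [hE] with χ hχ hmem
      have h2 : dualDil p (-1) χ ∈ annih p m := dualDil_mem_annih.2 (by rwa [sub_neg_eq_add])
      have h3 : B χ = fourier μ φ (dualDil p (-1) χ) * pair χ x := by
        rw [fourier_stepFunction hμ hKm hK hm h2]
      rw [h3, mul_right_comm, hχ]
      by_cases h : χ ∈ dualBall k ξ
      · rw [Set.indicator_of_mem h, Set.indicator_of_mem h, one_mul]
      · rw [Set.indicator_of_notMem h, Set.indicator_of_notMem h, zero_mul]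
    rw [setIntegral_congr_ae hSm h1, setIntegral_indicator (measurableSet_dualBall k ξ),
      Set.inter_eq_self_of_subset_right hsub, setIntegral_dualBall_pair hr ν hν, Set.indicator_apply]
    rfl
  -- the integrals against the partial sums
  have hJ : ∀ F, ∫ χ in S, B χ * P F χ ∂ν = p * ∑ h ∈ F, β h * φ (dil p 1 x - h) := by
    intro F
    -- The three factors combine into the value of χ at x - 𝒜⁻¹(a + h), and this point lies in
    -- G_{m+1} exactly when 𝒜x - h ∈ a + G_m. The factor p^{m+1}, against the p^{-m} in B, yields
    -- the p in `refine`.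
    have hterm : ∀ (a : Vilenkin p) (h : Vilenkin p),
        ∫ χ in S, conj (pair (dualDil p (-1) χ) a) * pair χ x *
          conj (pair (dualDil p (-1) χ) h) ∂ν =
        (p : ℂ) ^ (m + 1) * (ball m a).indicator (fun _ => 1) (dil p 1 x - h) := by
      intro a h
      have h1 : ∀ χ : Char p, conj (pair (dualDil p (-1) χ) a) * pair χ x *
          conj (pair (dualDil p (-1) χ) h) = pair χ (x - dil p (-1) (a + h)) := fun χ => by
        rw [pair_sub, map_add, pair_add, map_mul, pair_dualDil, pair_dualDil]
        ring
      have h2 : x - dil p (-1) (a + h) ∈ subG p (m + 1) ↔ dil p 1 x - h ∈ ball m a := by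
        rw [← dil_mem_subG, map_sub, dil_dil_neg, mem_ball, sub_sub, add_comm a h]
      simp only [h1]
      rw [hS, ← dualBall_one, setIntegral_dualBall_pair hr ν hν, pair_one, Set.indicator_apply]
      simp only [h2, mul_ite, mul_one, mul_zero]
    have hexp : ∀ χ, B χ * P F χ = ∑ h ∈ F, ∑ a ∈ R, (p : ℂ) ^ (-m) * β h * φ a *
        (conj (pair (dualDil p (-1) χ) a) * pair χ x * conj (pair (dualDil p (-1) χ) h)) := by
      intro χ
      rw [hB, hP]
      dsimp only
      rw [Finset.mul_sum]
      refine Finset.sum_congr rfl fun h _ => ?_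
      rw [Finset.mul_sum, Finset.sum_mul, Finset.sum_mul]
      refine Finset.sum_congr rfl fun a _ => ?_
      ring
    have hint : ∀ a h : Vilenkin p, Integrable (fun χ => conj (pair (dualDil p (-1) χ) a) *
        pair χ x * conj (pair (dualDil p (-1) χ) h)) (ν.restrict S) := fun a h =>
      Integrable.of_bound (((hcont a).mul (continuous_pair_left x)).mul
        (hcont h)).aestronglyMeasurable 1 (ae_of_all _ fun χ => by
          rw [norm_mul, norm_mul, RCLike.norm_conj, RCLike.norm_conj]; simp)
    simp only [hexp]
    rw [integral_finsetSum F (fun (h : H0 p) _ => integrable_finsetSum R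
      fun a _ => (hint a (h : Vilenkin p)).const_mul ((p : ℂ) ^ (-m) * β h * φ a)), Finset.mul_sum]
    refine Finset.sum_congr rfl fun h _ => ?_
    rw [integral_finsetSum R fun a _ => (hint a h).const_mul _,
      eq_sum_indicator_ball hKm hK hm (dil p 1 x - h), Finset.mul_sum, Finset.mul_sum]
    refine Finset.sum_congr rfl fun a _ => ?_
    rw [integral_const_mul, hterm]
    by_cases h' : dil p 1 x - (h : Vilenkin p) ∈ ball m a
    · rw [Set.indicator_of_mem h', Set.indicator_of_mem h', zpow_add₀ hp0, zpow_neg, zpow_one]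
      field_simp
    · rw [Set.indicator_of_notMem h', Set.indicator_of_notMem h']
      ring
  -- B is bounded and the L₁ norm on the finite measure space S is controlled by the L₂ norm, in
  -- which the mask series converges.
  have hzero : Tendsto (fun F => ∫ χ in S, B χ * (w χ - P F χ) ∂ν) atTop (𝓝 0) := by
    rw [tendsto_zero_iff_enorm_tendsto_zero]
    have hbound : ∀ F, ‖∫ χ in S, B χ * (w χ - P F χ) ∂ν‖ₑ ≤ ENNReal.ofReal C *
        (eLpNorm (fun χ => w χ - P F χ) 2 (ν.restrict S) *
          (ν.restrict S) Set.univ ^ (1 / (1 : ℝ≥0∞).toReal - 1 / (2 : ℝ≥0∞).toReal)) := by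
      intro F
      refine (enorm_integral_le_lintegral_enorm _).trans ?_
      refine le_trans ?_ (mul_le_mul_right
        (eLpNorm_le_eLpNorm_mul_rpow_measure_univ one_le_two (hws F)) (ENNReal.ofReal C))
      rw [eLpNorm_one_eq_lintegral_enorm, ← lintegral_const_mul' _ _ ENNReal.ofReal_ne_top]
      refine lintegral_mono fun χ => ?_
      rw [enorm_mul]
      gcongr
      rw [← ofReal_norm]
      exact ENNReal.ofReal_le_ofReal (hBC χ)
    refine tendsto_of_tendsto_of_tendsto_of_le_of_le tendsto_const_nhds ?_ (fun _ => zero_le) hbound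
    have hfin : (ν.restrict S) Set.univ ^ (1 / (1 : ℝ≥0∞).toReal - 1 / (2 : ℝ≥0∞).toReal) ≠ ⊤ :=
      ENNReal.rpow_ne_top_of_nonneg (by norm_num) (measure_ne_top _ _)
    have := ENNReal.Tendsto.const_mul (a := ENNReal.ofReal C)
      (ENNReal.Tendsto.mul_const hlim (Or.inr hfin)) (Or.inr ENNReal.ofReal_ne_top)
    simpa using this
  -- The mask series converges along finite subsets of H₀, which is the convergence that `HasSum`
  -- requires; x is fixed, so the identity holds at every point.
  have hsum : HasSum (fun h : H0 p => β h * φ (dil p 1 x - h))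
      ((p : ℂ)⁻¹ * ∫ χ in S, B χ * w χ ∂ν) := by
    have h1 : ∀ F, ∫ χ in S, B χ * (w χ - P F χ) ∂ν =
        ∫ χ in S, B χ * w χ ∂ν - p * ∑ h ∈ F, β h * φ (dil p 1 x - h) := fun F => by
      rw [← hJ, ← integral_sub hBw (hBP F)]
      simp only [mul_sub]
    simp only [h1] at hzero
    have h2 := (tendsto_const_nhds (x := ∫ χ in S, B χ * w χ ∂ν)).sub hzero
    simp only [sub_sub_cancel, sub_zero] at h2
    have h3 := h2.const_mul (p : ℂ)⁻¹
    simp only [inv_mul_cancel_left₀ hp0] at h3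
    exact h3
  unfold refine
  rw [hsum.tsum_eq, mul_inv_cancel_left₀ hp0, hI]

end Prime

/-! ### Density of step functions -/

theorem exists_ball_subset {U : Set (Vilenkin p)} (hU : IsOpen U) {x : Vilenkin p} (hx : x ∈ U) :
    ∃ n : ℤ, ball n x ⊆ U := by
  have h : (fun y => y + x) ⁻¹' U ∈ 𝓝 (0 : Vilenkin p) :=
    (hU.preimage (continuous_id.add continuous_const)).mem_nhds (by simpa using hx)
  obtain ⟨n, hn⟩ := mem_nhds_zero_iff.1 h
  refine ⟨n, fun y hy => ?_⟩
  have := hn hy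
  rwa [Set.mem_preimage, sub_add_cancel] at this

/-- Cosets centred at truncated points form a countable base: there are countably many levels and
countably many centres at each. -/
theorem borel_eq_generateFrom_ball [NeZero p] :
    borel (Vilenkin p) = MeasurableSpace.generateFrom {s | ∃ n a, s = ball n a} := by
  refine le_antisymm (MeasurableSpace.generateFrom_le fun U hU => ?_)
    (MeasurableSpace.generateFrom_le ?_)
  · have : U = ⋃ (n : ℤ) (a : lattice p n) (_ : ball n (a : Vilenkin p) ⊆ U),
        ball n (a : Vilenkin p) := by
      ext x
      simp only [Set.mem_iUnion]
      constructor
      · intro hx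
        obtain ⟨n, hn⟩ := exists_ball_subset hU hx
        refine ⟨n, ⟨trunc n x, trunc_mem_lattice n x⟩, ?_, mem_ball_trunc n x⟩
        rwa [← ball_eq_of_mem (mem_ball_trunc n x)]
      · rintro ⟨n, a, h, hx⟩
        exact h hx
    rw [this]
    exact MeasurableSet.iUnion fun n => MeasurableSet.iUnion fun a => MeasurableSet.iUnion fun _ =>
      MeasurableSpace.measurableSet_generateFrom ⟨n, a, rfl⟩
  · rintro _ ⟨n, a, rfl⟩
    exact measurableSet_ball n a

theorem ball_inter_ball {n m : ℤ} {a b c : Vilenkin p} (ha : c ∈ ball n a) (hb : c ∈ ball m b) :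
    ball n a ∩ ball m b = ball (max n m) c := by
  rw [← ball_eq_of_mem ha, ← ball_eq_of_mem hb]
  refine Set.Subset.antisymm ?_ fun x hx =>
    ⟨ball_subset (le_max_left n m) c hx, ball_subset (le_max_right n m) c hx⟩
  rintro x ⟨h1, h2⟩
  rcases le_total n m with h | h
  · rwa [max_eq_right h]
  · rwa [max_eq_left h]

theorem isPiSystem_ball : IsPiSystem {s : Set (Vilenkin p) | ∃ n a, s = ball n a} := by
  rintro _ ⟨n, a, rfl⟩ _ ⟨m, b, rfl⟩ ⟨c, ha, hb⟩
  exact ⟨_, _, ball_inter_ball ha hb⟩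

theorem memLp_two_integrableOn {μ : Measure (Vilenkin p)} {f : Vilenkin p → ℂ}
    (hf : MemLp f 2 μ) {s : Set (Vilenkin p)} (h : μ s ≠ ⊤) : IntegrableOn f s μ := by
  have : IsFiniteMeasure (μ.restrict s) :=
    ⟨by rwa [Measure.restrict_apply_univ, lt_top_iff_ne_top]⟩
  exact (hf.restrict s).integrable one_le_two

/-- Cosets form a π-system generating the Borel sets. The induction runs inside one coset of G_0,
where f is integrable, so that complements can be taken; the countably many cosets are then summed.
-/
theorem setIntegral_eq_zero_of_forall_ball [NeZero p] {μ : Measure (Vilenkin p)}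
    {f : Vilenkin p → ℂ} (hint : ∀ n a, IntegrableOn f (ball n a) μ)
    (hf : ∀ n a, ∫ x in ball n a, f x ∂μ = 0) {s : Set (Vilenkin p)} (hs : MeasurableSet s)
    (hfs : IntegrableOn f s μ) : ∫ x in s, f x ∂μ = 0 := by
  have key : ∀ c, ∀ s : Set (Vilenkin p), MeasurableSet s →
      ∫ x in s, f x ∂(μ.restrict (ball 0 c)) = 0 := by
    intro c s hs
    refine MeasurableSpace.induction_on_inter
      (C := fun s _ => ∫ x in s, f x ∂(μ.restrict (ball 0 c)) = 0)
      borel_eq_generateFrom_ball isPiSystem_ball (by simp) ?_ ?_ ?_ s hs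
    · rintro _ ⟨n, a, rfl⟩
      rw [Measure.restrict_restrict (measurableSet_ball n a)]
      rcases Set.eq_empty_or_nonempty (ball n a ∩ ball 0 c) with h | ⟨b, h1, h2⟩
      · rw [h, setIntegral_empty]
      · rw [ball_inter_ball h1 h2, hf]
    · intro t ht h
      have := integral_add_compl (μ := μ.restrict (ball 0 c)) (f := f) ht (hint 0 c)
      rwa [h, zero_add, hf] at this
    · intro g hg hgm h
      rw [integral_iUnion hgm hg (hint 0 c).integrableOn]
      simp only [h, tsum_zero]
  have hs' : s = ⋃ a : lattice p 0, s ∩ ball 0 (a : Vilenkin p) := by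
    rw [← Set.inter_iUnion, iUnion_ball_lattice, Set.inter_univ]
  rw [hs'] at hfs ⊢
  rw [integral_iUnion (fun a => hs.inter (measurableSet_ball _ _))
    (fun a b hab => (pairwise_disjoint_ball_lattice 0 hab).mono Set.inter_subset_right
      Set.inter_subset_right) hfs]
  simp only [← Measure.restrict_restrict hs, key _ s hs, tsum_zero]

/-- The step functions in `L₂(G)`: the span of the indicators of cosets. -/
def stepSpan {μ : Measure (Vilenkin p)} (hμ : ∀ n (a : Vilenkin p), μ (ball n a) ≠ ⊤) :
    Submodule ℂ (Lp ℂ 2 μ) :=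
  Submodule.span ℂ (Set.range fun na : ℤ × Vilenkin p =>
    indicatorConstLp 2 (measurableSet_ball na.1 na.2) (hμ na.1 na.2) (1 : ℂ))

/-- A function orthogonal to all indicators of cosets has zero integral over every coset, hence over
every set of finite measure, and so vanishes almost everywhere. -/
theorem topologicalClosure_stepSpan [NeZero p] {μ : Measure (Vilenkin p)}
    (hμ : ∀ n (a : Vilenkin p), μ (ball n a) ≠ ⊤) : (stepSpan hμ).topologicalClosure = ⊤ := by
  rw [Submodule.topologicalClosure_eq_top_iff, Submodule.eq_bot_iff]
  intro f hf
  have hint : ∀ n a, IntegrableOn f (ball n a) μ := fun n a =>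
    memLp_two_integrableOn (Lp.memLp f) (hμ n a)
  have h0 : ∀ n a, ∫ x in ball n a, f x ∂μ = 0 := fun n a => by
    rw [← L2.inner_indicatorConstLp_one (𝕜 := ℂ) (measurableSet_ball n a) (hμ n a)]
    exact (Submodule.mem_orthogonal _ _).1 hf _ (Submodule.subset_span ⟨(n, a), rfl⟩)
  have hfs : ∀ s : Set (Vilenkin p), MeasurableSet s → μ s < ⊤ → IntegrableOn f s μ :=
    fun s _ hs => memLp_two_integrableOn (Lp.memLp f) hs.ne
  refine Lp.eq_zero_iff_ae_eq_zero.2 (Lp.ae_eq_zero_of_forall_setIntegral_eq_zero f two_ne_zero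
    ENNReal.ofNat_ne_top hfs fun s hs hs' => ?_)
  exact setIntegral_eq_zero_of_forall_ball hint h0 hs (hfs s hs hs')

theorem exists_stepFunction_of_mem_stepSpan {μ : Measure (Vilenkin p)}
    (hμ : ∀ n (a : Vilenkin p), μ (ball n a) ≠ ⊤) {f : Lp ℂ 2 μ} (hf : f ∈ stepSpan hμ) :
    ∃ (g : Vilenkin p → ℂ) (K m : ℤ), f =ᵐ[μ] g ∧ (∀ x, x ∉ subG p K → g x = 0) ∧
      ∀ x, ∀ y ∈ subG p m, g (x + y) = g x := by
  induction hf using Submodule.span_induction with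
  | mem f hf =>
    obtain ⟨⟨n, a⟩, rfl⟩ := hf
    obtain ⟨L, hL⟩ := a.2
    refine ⟨_, min n L, n, indicatorConstLp_coeFn, fun x hx => Set.indicator_of_notMem ?_ _,
      fun x y hy => ?_⟩
    · intro h
      refine hx ?_
      have h1 : x - a ∈ subG p (min n L) := subG_anti (min_le_left n L) h
      have h2 : a ∈ subG p (min n L) := fun k hk => hL k (hk.trans_le (min_le_right n L))
      have := add_mem h1 h2
      rwa [sub_add_cancel] at this
    · have hmem : x + y ∈ ball n a ↔ x ∈ ball n a := by
        rw [mem_ball, mem_ball, add_sub_right_comm]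
        exact AddSubgroup.add_mem_cancel_right _ hy
      by_cases h : x ∈ ball n a
      · rw [Set.indicator_of_mem h, Set.indicator_of_mem (hmem.2 h)]
      · rw [Set.indicator_of_notMem h, Set.indicator_of_notMem (mt hmem.1 h)]
  | zero => exact ⟨0, 0, 0, Lp.coeFn_zero _ _ _, fun _ _ => rfl, fun _ _ _ => rfl⟩
  | add f₁ f₂ _ _ h₁ h₂ =>
    obtain ⟨g₁, K₁, m₁, hg₁, hK₁, hm₁⟩ := h₁
    obtain ⟨g₂, K₂, m₂, hg₂, hK₂, hm₂⟩ := h₂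
    refine ⟨g₁ + g₂, min K₁ K₂, max m₁ m₂, (Lp.coeFn_add f₁ f₂).trans (hg₁.add hg₂),
      fun x hx => ?_, fun x y hy => ?_⟩
    · rw [Pi.add_apply, hK₁ x fun h => hx (subG_anti (min_le_left _ _) h),
        hK₂ x fun h => hx (subG_anti (min_le_right _ _) h), add_zero]
    · rw [Pi.add_apply, Pi.add_apply, hm₁ x y (subG_anti (le_max_left _ _) hy),
        hm₂ x y (subG_anti (le_max_right _ _) hy)]
  | smul c f _ h =>
    obtain ⟨g, K, m, hg, hK, hm⟩ := h
    refine ⟨c • g, K, m, (Lp.coeFn_smul c f).trans (hg.const_smul c), fun x hx => ?_,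
      fun x y hy => ?_⟩
    · rw [Pi.smul_apply, hK x hx, smul_zero]
    · rw [Pi.smul_apply, Pi.smul_apply, hm x y hy]

/-- The `ℓ²` norm of the coefficients of a family of vectors is a seminorm. -/
theorem exists_seminorm_sq_eq_tsum {H ι : Type*} [NormedAddCommGroup H] [InnerProductSpace ℂ H]
    (v : ι → H) : ∃ N : H → ℝ≥0∞, (∀ f, N f ^ 2 = ∑' i, ‖inner ℂ (v i) f‖ₑ ^ 2) ∧
      ∀ f g, N (f + g) ≤ N f + N g := by
  -- The ℓ² norm is taken as the L₂ norm for counting measure, so that subadditivity is Minkowski's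
  -- inequality; the σ-algebra ⊤ makes every family measurable.
  let _ : MeasurableSpace ι := ⊤
  have : MeasurableSingletonClass ι := ⟨fun _ => trivial⟩
  have hmeas : ∀ f : H, AEStronglyMeasurable (fun i => inner ℂ (v i) f)
      (Measure.count : Measure ι) := fun f =>
    (measurable_from_top (f := fun i => inner ℂ (v i) f)).aestronglyMeasurable
  refine ⟨fun f => eLpNorm (fun i => inner ℂ (v i) f) 2 (Measure.count : Measure ι),
    fun f => ?_, fun f g => ?_⟩
  · have := eLpNorm_nnreal_pow_eq_lintegral (f := fun i => inner ℂ (v i) f) (p := 2)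
      (μ := (Measure.count : Measure ι)) two_ne_zero
    rw [lintegral_count] at this
    simpa using this
  · simp only [inner_add_right]
    exact eLpNorm_add_le (hmeas f) (hmeas g) one_le_two

/-- A family satisfying Parseval's identity on a dense subspace satisfies it everywhere. -/
theorem tsum_enorm_inner_sq_of_dense {H ι : Type*} [NormedAddCommGroup H] [InnerProductSpace ℂ H]
    (v : ι → H) {D : Submodule ℂ H} (hD : D.topologicalClosure = ⊤)
    (h : ∀ f ∈ D, ∑' i, ‖inner ℂ (v i) f‖ₑ ^ 2 = ‖f‖ₑ ^ 2) (f : H) :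
    ∑' i, ‖inner ℂ (v i) f‖ₑ ^ 2 = ‖f‖ₑ ^ 2 := by
  obtain ⟨N, hN, hadd⟩ := exists_seminorm_sq_eq_tsum v
  have hdense : ∀ (P : H → Prop), IsClosed {f | P f} → (∀ f ∈ D, P f) → ∀ f, P f := by
    intro P hP hPD f
    have hf : f ∈ closure (D : Set H) := by
      rw [← Submodule.topologicalClosure_coe, hD]
      trivial
    exact closure_minimal (show (D : Set H) ⊆ {f | P f} from hPD) hP hf
  -- Each finite partial sum is continuous, so its bound by the squared norm extends from D by
  -- closure.
  have hupper : ∀ f, N f ≤ ‖f‖ₑ := by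
    intro f
    rw [← ENNReal.pow_le_pow_left_iff two_ne_zero, hN, ENNReal.tsum_eq_iSup_sum]
    refine iSup_le fun F => ?_
    refine hdense (fun f => ∑ i ∈ F, ‖inner ℂ (v i) f‖ₑ ^ 2 ≤ ‖f‖ₑ ^ 2) ?_ ?_ f
    · refine isClosed_le (continuous_finsetSum _ fun i _ => ?_) ?_
      · exact (ENNReal.continuous_pow 2).comp
          (continuous_enorm.comp (continuous_const.inner continuous_id))
      · exact (ENNReal.continuous_pow 2).comp continuous_enorm
    · intro f hf
      rw [← h f hf]
      exact ENNReal.sum_le_tsum F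
  -- With f fixed, the condition on g is closed. On D it follows from ‖g‖ = N g ≤ N f + N (g - f)
  -- and the upper bound. Taking g = f gives the claim without continuity of N.
  have hlower : ‖f‖ₑ ≤ N f := by
    have := hdense (fun g => ‖g‖ₑ ≤ N f + ‖g - f‖ₑ) ?_ ?_ f
    · simpa using this
    · exact isClosed_le continuous_enorm (continuous_const.add
        (continuous_enorm.comp (continuous_id.sub continuous_const)))
    · intro g hg
      have h1 : ‖g‖ₑ = N g := by
        refine (ENNReal.pow_right_strictMono two_ne_zero).injective ?_
        rw [hN, h g hg]
      have h2 := hadd f (g - f)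
      rw [add_sub_cancel] at h2
      rw [h1]
      exact h2.trans (by gcongr; exact hupper _)
  rw [← hN, le_antisymm (hupper f) hlower]

/-! ### Dilates and translates of a modulated indicator -/

theorem atom_eq_indicator {ψ : Vilenkin p → ℂ} {k : ℤ} {ξ : Char p} {c : ℂ}
    (hψ : ∀ x, ψ x = (subG p k : Set (Vilenkin p)).indicator (fun y => c * pair ξ y) x)
    (n : ℤ) (h : Vilenkin p) :
    atom ψ n h = (ball (k + n) (dil p (-n) h)).indicator fun x =>
      (((p : ℝ) ^ ((n : ℝ) / 2) : ℝ) : ℂ) * c * conj (pair ξ h) * pair (dualDil p n ξ) x := by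
  funext x
  have hmem : dil p n x - h ∈ (subG p k : Set (Vilenkin p)) ↔
      x ∈ ball (k + n) (dil p (-n) h) := by
    rw [mem_ball, ← dil_mem_subG, map_sub, dil_dil_neg]
    rfl
  unfold atom
  rw [hψ]
  by_cases hx : x ∈ ball (k + n) (dil p (-n) h)
  · rw [Set.indicator_of_mem hx, Set.indicator_of_mem (hmem.2 hx), pair_sub, pair_dualDil]
    ring
  · rw [Set.indicator_of_notMem hx, Set.indicator_of_notMem (mt hmem.1 hx), mul_zero]

theorem memLp_indicator_ball_pair {μ : Measure (Vilenkin p)} {k : ℤ} {a : Vilenkin p}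
    (hμ : μ (ball k a) ≠ ⊤) (c : ℂ) (ξ : Char p) :
    MemLp ((ball k a).indicator fun x => c * pair ξ x) 2 μ := by
  rw [memLp_indicator_iff_restrict (measurableSet_ball k a)]
  have : IsFiniteMeasure (μ.restrict (ball k a)) :=
    ⟨by rwa [Measure.restrict_apply_univ, lt_top_iff_ne_top]⟩
  exact MemLp.of_bound (continuous_const.mul (continuous_pair ξ)).aestronglyMeasurable ‖c‖
    (ae_of_all _ fun x => by rw [norm_mul, norm_pair, mul_one])

theorem memLp_atom {μ : Measure (Vilenkin p)} (hμ : ∀ n (a : Vilenkin p), μ (ball n a) ≠ ⊤)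
    {ψ : Vilenkin p → ℂ} {k : ℤ} {ξ : Char p} {c : ℂ}
    (hψ : ∀ x, ψ x = (subG p k : Set (Vilenkin p)).indicator (fun y => c * pair ξ y) x)
    (n : ℤ) (h : Vilenkin p) : MemLp (atom ψ n h) 2 μ := by
  rw [atom_eq_indicator hψ]
  exact memLp_indicator_ball_pair (hμ _ _) _ _

theorem integral_mul_conj_atom (μ : Measure (Vilenkin p)) (f : Vilenkin p → ℂ)
    {ψ : Vilenkin p → ℂ} {k : ℤ} {ξ : Char p} {c : ℂ}
    (hψ : ∀ x, ψ x = (subG p k : Set (Vilenkin p)).indicator (fun y => c * pair ξ y) x)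
    (n : ℤ) (h : Vilenkin p) :
    ∫ x, f x * conj (atom ψ n h x) ∂μ = (((p : ℝ) ^ ((n : ℝ) / 2) : ℝ) : ℂ) * conj c *
      pair ξ h * coeff μ f (k + n) (dualDil p n ξ) (dil p (-n) h) := by
  unfold coeff
  rw [← integral_const_mul, ← integral_indicator (measurableSet_ball _ _)]
  refine integral_congr_ae (ae_of_all _ fun x => ?_)
  dsimp only
  rw [atom_eq_indicator hψ]
  by_cases hx : x ∈ ball (k + n) (dil p (-n) h)
  · rw [Set.indicator_of_mem hx, Set.indicator_of_mem hx]
    simp only [map_mul, Complex.conj_conj, Complex.conj_ofReal]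
    ring
  · rw [Set.indicator_of_notMem hx, Set.indicator_of_notMem hx, map_zero, mul_zero]

/-- The dilation `𝒜⁻ⁿ` maps `H₀` onto the points with digits below `n`. -/
def dilLatticeEquiv (p : ℕ) (n : ℤ) : H0 p ≃ lattice p n where
  toFun h := ⟨dil p (-n) h, fun k hk => by
    rw [coord_dil]
    exact h.2 _ (by linarith)⟩
  invFun a := ⟨dil p n a, fun k hk => by
    rw [coord_dil]
    exact a.2 _ (by linarith)⟩
  left_inv h := Subtype.ext (dil_dil_neg n _)
  right_inv a := Subtype.ext (dil_neg_dil n _)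

/-- The centres 𝒜⁻ⁿh run over all points with digits below n, while the atoms live on cosets of the
larger group G_{n-s}, so each coset occurs p^s times. Together with the squared amplitude p^n
p^{-2s} this is p^{n-s}, the weight in `energy`. -/
theorem tsum_enorm_integral_mul_conj_atom [hp : Fact p.Prime] (μ : Measure (Vilenkin p))
    (f : Vilenkin p → ℂ) {ψ : Vilenkin p → ℂ} {s : ℕ} {ξ : Char p}
    (hψ : ∀ x, ψ x = (subG p (-(s : ℤ)) : Set (Vilenkin p)).indicator
      (fun y => (p : ℂ) ^ (-(s : ℤ)) * pair ξ y) x) (n : ℤ) :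
    ∑' h : H0 p, ‖∫ x, f x * conj (atom ψ n h x) ∂μ‖ₑ ^ 2 =
      energy μ f (-(s : ℤ) + n) (dualDil p n ξ) := by
  have hc : ‖(((p : ℝ) ^ ((n : ℝ) / 2) : ℝ) : ℂ)‖ₑ ^ 2 = (p : ℝ≥0∞) ^ n := by
    have h0 : (0 : ℝ) < p := Nat.cast_pos.2 hp.out.pos
    rw [← ofReal_norm, Complex.norm_real, Real.norm_of_nonneg (by positivity),
      ← ENNReal.ofReal_pow (by positivity), ← Real.rpow_mul_natCast h0.le]
    rw [Nat.cast_ofNat, div_mul_cancel₀ _ (two_ne_zero), Real.rpow_intCast,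
      ← toReal_natCast_zpow, ENNReal.ofReal_toReal (prime_zpow_ne_top n)]
  have hk : ‖conj ((p : ℂ) ^ (-(s : ℤ)))‖ₑ = (p : ℝ≥0∞) ^ (-(s : ℤ)) := by
    rw [← ofReal_norm, RCLike.norm_conj, norm_zpow, Complex.norm_natCast, ← toReal_natCast_zpow,
      ENNReal.ofReal_toReal (prime_zpow_ne_top _)]
  have hterm : ∀ h : H0 p, ‖∫ x, f x * conj (atom ψ n h x) ∂μ‖ₑ ^ 2 =
      (p : ℝ≥0∞) ^ n * (p : ℝ≥0∞) ^ (-(s : ℤ)) * (p : ℝ≥0∞) ^ (-(s : ℤ)) *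
        ‖coeff μ f (-(s : ℤ) + n) (dualDil p n ξ) (dilLatticeEquiv p n h)‖ₑ ^ 2 := by
    intro h
    rw [integral_mul_conj_atom μ f hψ, enorm_mul, enorm_mul, enorm_mul, enorm_pair, mul_one,
      mul_pow, mul_pow, hc, hk, sq ((p : ℝ≥0∞) ^ (-(s : ℤ))), ← mul_assoc]
    rfl
  have hn : n = -(s : ℤ) + n + s := by ring
  simp only [hterm]
  rw [ENNReal.tsum_mul_left, (dilLatticeEquiv p n).tsum_eq fun a : lattice p n =>
    ‖coeff μ f (-(s : ℤ) + n) (dualDil p n ξ) a‖ₑ ^ 2]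
  have hsum := tsum_lattice_add (-(s : ℤ) + n) s
    (fun a => ‖coeff μ f (-(s : ℤ) + n) (dualDil p n ξ) a‖ₑ ^ 2) fun x y hy => by
      rw [coeff_congr_ball μ f _ (show x + y ∈ ball (-(s : ℤ) + n) x by
        rwa [mem_ball, add_sub_cancel_left])]
  rw [← hn] at hsum
  rw [hsum]
  unfold energy
  rw [← zpow_natCast, ← mul_assoc, ← prime_zpow_add, ← prime_zpow_add, ← prime_zpow_add]
  congr 2
  ring

/-! ### Tilings of the dual group by dilates -/

theorem coset_eq_dualBall (r : ℤ → Char p) (M s : ℕ) (α : ℤ → Fin p) :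
    coset r M s α = dualBall (-(s : ℤ)) (∏ k ∈ Finset.Icc (-(s : ℤ)) (M : ℤ), r k ^ (α k : ℕ)) := by
  ext χ
  constructor
  · rintro ⟨ω, hω, rfl⟩
    rw [mem_dualBall, mul_comm ω, inv_mul_cancel_left]
    exact hω
  · intro h
    exact ⟨_, h, by rw [mul_comm, mul_inv_cancel_left]⟩

theorem dualBall_subset_annih {k n : ℤ} (hkn : k ≤ n) {ξ : Char p} (hξ : ξ ∈ annih p n) :
    dualBall k ξ ⊆ (annih p n : Set (Char p)) := fun χ hχ => by
  have := mul_mem hξ (annih_mono hkn hχ)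
  rwa [mul_inv_cancel_left] at this

/-- Dilation by n carries the shell G_{M+1}^⊥ \ G_M^⊥ onto G_{M+1+n}^⊥ \ G_{M+n}^⊥, so tiling one
shell tiles them all. -/
theorem iUnion_dualDil_image {ι : Type*} (E : ι → Set (Char p)) (t : ι → ℤ) (M : ℤ)
    (htile : ⋃ j, dualDil p (t j) '' E j = (annih p (M + 1) : Set (Char p)) \ annih p M) :
    ⋃ a : ι × ℤ, dualDil p a.2 '' E a.1 =
      (⋃ k, (annih p k : Set (Char p))) \ ⋂ k, (annih p k : Set (Char p)) := by
  ext χ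
  simp only [Set.mem_iUnion, Set.mem_sdiff, Set.mem_iInter, Prod.exists]
  constructor
  · rintro ⟨j, n, η, hη, rfl⟩
    have h : dualDil p (t j) η ∈ (annih p (M + 1) : Set (Char p)) \ annih p M := by
      rw [← htile]
      exact Set.mem_iUnion.2 ⟨j, η, hη, rfl⟩
    obtain ⟨h1, h2⟩ := h
    rw [SetLike.mem_coe, dualDil_mem_annih] at h1 h2
    refine ⟨⟨M + 1 - t j + n, dualDil_mem_annih.2 (by rwa [add_sub_cancel_right])⟩, fun h => h2 ?_⟩
    have := dualDil_mem_annih.1 (h (M - t j + n))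
    rwa [add_sub_cancel_right] at this
  · rintro ⟨hex, hall⟩
    obtain ⟨b, hb⟩ := not_forall.1 hall
    -- The least l with χ ∈ G_l^⊥ identifies the shell of χ; dilation by M + 1 - l moves it to the
    -- given one.
    obtain ⟨l, hl, hmin⟩ := Int.exists_least_of_bdd (P := fun k => χ ∈ annih p k)
      ⟨b, fun z hz => not_lt.1 fun h => hb (annih_mono h.le hz)⟩ hex
    have hmem : dualDil p (M + 1 - l) χ ∈ (annih p (M + 1) : Set (Char p)) \ annih p M := by
      refine ⟨dualDil_mem_annih.2 (by simpa using hl), fun h => ?_⟩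
      have := hmin _ (dualDil_mem_annih.1 h)
      linarith
    rw [← htile] at hmem
    obtain ⟨j, η, hη, h⟩ := Set.mem_iUnion.1 hmem
    refine ⟨j, -(M + 1 - l) + t j, η, hη, ?_⟩
    dsimp only
    rw [dualDil_add, h, ← dualDil_add, neg_add_cancel, dualDil_zero]

theorem enorm_sq_Lp {μ : Measure (Vilenkin p)} (f : Lp ℂ 2 μ) :
    ‖f‖ₑ ^ 2 = ∫⁻ x, ‖f x‖ₑ ^ 2 ∂μ := by
  have := eLpNorm_nnreal_pow_eq_lintegral (f := f) (p := 2) (μ := μ) two_ne_zero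
  rw [Lp.enorm_def]
  simpa using this

end Vilenkin

end

/-! ### The Parseval frame identity. -/

theorem theorem3p1 {p : ℕ} [Fact p.Prime]
    -- Haar measures on the group and on its dual, normalized on `G_0` and `G_0^⊥`
    (μ : Measure (Vilenkin p)) [μ.IsAddHaarMeasure]
    (hμ : μ (Vilenkin.subG p 0 : Set (Vilenkin p)) = 1)
    (ν : Measure (Vilenkin.Char p)) [ν.IsHaarMeasure]
    (hν : ν (Vilenkin.annih p 0 : Set (Vilenkin.Char p)) = 1)
    (r : ℤ → Vilenkin.Char p) (hr : Vilenkin.IsRademacher r)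
    -- a step refinable function with its mask `m₀`
    (M N : ℕ) (φ : Vilenkin p → ℂ) (hφ : Vilenkin.StepClass μ M N φ)
    (β₀ : Vilenkin.H0 p → ℂ) (m₀ : Vilenkin.Char p → ℂ) (hm₀ : Vilenkin.IsMask ν β₀ m₀)
    (hrefine : ∀ x, φ x = Vilenkin.refine φ β₀ x)
    -- the masks `m_j`
    (q : ℕ) (β : Fin q → Vilenkin.H0 p → ℂ) (m : Fin q → Vilenkin.Char p → ℂ)
    (hm : ∀ j, Vilenkin.IsMask ν (β j) (m j))
    -- the cosets `E_j`
    (s : Fin q → ℕ) (α : Fin q → ℤ → Fin p) (E : Fin q → Set (Vilenkin.Char p))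
    (hE : ∀ j, E j = Vilenkin.coset r M (s j) (α j))
    (hmE : ∀ j, ∀ᵐ χ ∂ν, Vilenkin.fourier μ φ (Vilenkin.dualDil p (-1) χ) * m j χ =
      (E j).indicator (fun _ => (1 : ℂ)) χ)
    (hdisj : Pairwise fun a b : Fin q × ℤ =>
      Disjoint (Vilenkin.dualDil p a.2 '' E a.1) (Vilenkin.dualDil p b.2 '' E b.1))
    (t : Fin q → ℕ)
    (htile : ⋃ j, Vilenkin.dualDil p (t j) '' E j =
      (Vilenkin.annih p (M + 1) : Set (Vilenkin.Char p)) \ Vilenkin.annih p M) :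
    Vilenkin.GeneratesTightFrame μ (fun j => Vilenkin.refine φ (β j)) := by
  open Vilenkin in
  have hfin : ∀ n (a : Vilenkin p), μ (ball n a) ≠ ⊤ := measure_ball_ne_top μ hμ
  set ξ : Fin q → Char p := fun j =>
    ∏ k ∈ Finset.Icc (-(s j : ℤ)) (M : ℤ), r k ^ (α j k : ℕ) with hξ
  have hEball : ∀ j, E j = dualBall (-(s j : ℤ)) (ξ j) := fun j => by
    rw [hE, coset_eq_dualBall]
  -- The highest factor is a power of r_M, which lies in G_{M+1}^⊥; hence E_j ⊂ G_{M+1}^⊥, as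
  -- `refine_eq_indicator` needs.
  have hξmem : ∀ j, ξ j ∈ annih p (M + 1) := fun j =>
    prod_mem fun k hk => pow_mem (annih_mono (by linarith [(Finset.mem_Icc.1 hk).2]) (hr k).1) _
  have hψ : ∀ j x, refine φ (β j) x = (subG p (-(s j : ℤ)) : Set (Vilenkin p)).indicator
      (fun y => (p : ℂ) ^ (-(s j : ℤ)) * pair (ξ j) y) x := fun j x =>
    refine_eq_indicator hr hμ hν (by linarith [Int.natCast_nonneg N, Int.natCast_nonneg M] :
      -(N : ℤ) ≤ M) hφ.2.1 hφ.2.2 (hm j)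
      (dualBall_subset_annih (by linarith [Int.natCast_nonneg (s j), Int.natCast_nonneg M])
        (hξmem j)) (by rw [← hEball]; exact hmE j) x
  have hatom : ∀ i : Fin q × ℤ × H0 p, MemLp (atom (refine φ (β i.1)) i.2.1 i.2.2) 2 μ := fun i =>
    memLp_atom hfin (hψ i.1) _ _
  refine ⟨fun j => ?_, fun f => ?_⟩
  · have : refine φ (β j) = (ball (-(s j : ℤ)) 0).indicator
        (fun y => (p : ℂ) ^ (-(s j : ℤ)) * pair (ξ j) y) := by
      rw [ball_zero]
      exact funext (hψ j)
    dsimp only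
    rw [this]
    exact memLp_indicator_ball_pair (hfin _ _) _ _
  have hball : ∀ a : Fin q × ℤ, dualDil p a.2 '' E a.1 =
      dualBall (-(s a.1 : ℤ) + a.2) (dualDil p a.2 (ξ a.1)) := fun a => by
    rw [hEball, dualDil_image_dualBall]
  have hunion := iUnion_dualDil_image E (fun j => (t j : ℤ)) M htile
  simp only [hball] at hdisj hunion
  -- For a step function, the sum over h is the energy in one tile E_j𝒜ⁿ, and the sum over (j, n)
  -- runs over the whole tiling.
  have hstep : ∀ g : Vilenkin p → ℂ, (∀ n a, IntegrableOn g (ball n a) μ) →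
      ∀ K l : ℤ, (∀ x, x ∉ subG p K → g x = 0) → (∀ x, ∀ y ∈ subG p l, g (x + y) = g x) →
      ∑' i : Fin q × ℤ × H0 p, ‖∫ x, g x * conj (atom (refine φ (β i.1)) i.2.1 i.2.2 x) ∂μ‖ₑ ^ 2 =
        ∫⁻ x, ‖g x‖ₑ ^ 2 ∂μ := by
    intro g hg K l hK hl
    rw [← tsum_energy_of_tiling hr ν hν hμ hg hK hl
      (fun a : Fin q × ℤ => -(s a.1 : ℤ) + a.2) (fun a => dualDil p a.2 (ξ a.1)) hdisj hunion,
      ENNReal.tsum_prod', ENNReal.tsum_prod']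
    refine tsum_congr fun j => ?_
    rw [ENNReal.tsum_prod']
    exact tsum_congr fun n => tsum_enorm_integral_mul_conj_atom μ g (hψ j) n
  set v : Fin q × ℤ × H0 p → Lp ℂ 2 μ := fun i => (hatom i).toLp _ with hv
  have hinner : ∀ (f : Lp ℂ 2 μ) i, inner ℂ (v i) f =
      ∫ x, f x * conj (atom (refine φ (β i.1)) i.2.1 i.2.2 x) ∂μ := fun f i => by
    rw [L2.inner_def]
    refine integral_congr_ae ?_
    filter_upwards [(hatom i).coeFn_toLp] with x hx
    rw [hv, hx, RCLike.inner_apply]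
  have hparseval := tsum_enorm_inner_sq_of_dense v (topologicalClosure_stepSpan hfin)
    (fun f hf => by
      obtain ⟨g, K, l, hfg, hK, hl⟩ := exists_stepFunction_of_mem_stepSpan hfin hf
      have hgLp : MemLp g 2 μ := (memLp_congr_ae hfg).1 (Lp.memLp f)
      have h1 : ∀ i, inner ℂ (v i) f =
          ∫ x, g x * conj (atom (refine φ (β i.1)) i.2.1 i.2.2 x) ∂μ := fun i => by
        rw [hinner]
        refine integral_congr_ae ?_
        filter_upwards [hfg] with x hx
        rw [hx]
      simp only [h1]
      rw [hstep g (fun n a => memLp_two_integrableOn hgLp (hfin n a)) K l hK hl, enorm_sq_Lp]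
      refine lintegral_congr_ae ?_
      filter_upwards [hfg] with x hx
      rw [hx]) f
  simp only [hinner] at hparseval
  -- The identity was proved in [0, ∞]; finiteness of the total turns it into convergence of the
  -- real series.
  have hne : ∑' i : Fin q × ℤ × H0 p,
      ‖∫ x, f x * conj (atom (refine φ (β i.1)) i.2.1 i.2.2 x) ∂μ‖ₑ ^ 2 ≠ ⊤ := by
    rw [hparseval]
    exact ENNReal.pow_ne_top enorm_ne_top
  have := ENNReal.hasSum_toReal hne
  rw [← ENNReal.tsum_toReal_eq fun i => ENNReal.pow_ne_top enorm_ne_top, hparseval] at this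
  simpa only [ENNReal.toReal_pow, toReal_enorm] using this
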